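/- **Setting.** Let $S^2=\mathbb{C}\cup\{\infty\}$ and let $\bar{\mathcal M}_{k+1}$ be the Deligne–Mumford space, with the Gromov topology, of isomorphism classes of stable nodal curves $\mathbf z$ of genus zero with marked points $z_0,\dots,z_k$. Such a curve is modelled over a labelled tree whose vertices $\alpha$ correspond to components $S_\alpha\cong S^2$, each with at least three special points (nodes $z_{\alpha\beta}$ and marked points). Let $\mathcal M_n$ be the manifold of $n$ pairwise distinct points on $S^2$ modulo Möbius transformations. For a vertex $\alpha$, let $z_{\alpha i}\in S_\alpha$ be $z_i$ if $z_i$ lies on $S_\alpha$, and otherwise the node on $S_\alpha$ leading to the component that carries $z_i$. Let $S_{\alpha_0}$ be the component carrying $z_0$. A *stable decomposition* is a partition $\mathbf I=(I_0,\dots,I_\ell)$ of $\{0,\dots,k\}$ into nonempty sets with $I_0=\{0\}$ and $|\mathbf I|:=\ell+1\ge 3$, ordered so that the minima $i_j:=\min I_j$ satisfy $0=i_0<i_1<\dots<i_\ell$. Let $\mathcal M_{\mathbf I}\subset\bar{\mathcal M}_{k+1}$ be the set of curves such that $z_{\alpha_0 i}=z_{\alpha_0 j}$ if and only if $i,j$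 lie in the same $I_a$, and let $$p_{\mathbf I}:\mathcal M_{\mathbf I}\to\mathcal M_{|\mathbf I|},\qquad \mathbf z\mapsto[z_{\alpha_0i_0},\dots,z_{\alpha_0i_\ell}].$$ Let $Z$ be a real Banach space. A continuous map $F:\bar{\mathcal M}_{k+1}\to Z$ is *coherent* if (a) $F$ vanishes in a neighbourhood of each $\mathcal M_{\mathbf I}$ with $|\mathbf I|=3$, and (b) for every stable decomposition $\mathbf I$ with $|\mathbf I|\ge 4$ there is a smooth map $F_{\mathbf I}:\mathcal M_{|\mathbf I|}\to Z$ with $F|_{\mathcal M_{\mathbf I}}=F_{\mathbf I}\circ p_{\mathbf I}$ (this $F_{\mathbf I}$ is unique, since $p_{\mathbf I}$ is surjective). Let $\mathrm{Coh}(\bar{\mathcal M}_{k+1},Z)$ be the vector space of coherent maps, with the coarsest topology for which $F\mapsto F$ is continuous into the $C^0$-topology (uniform convergence) on $\bar{\mathcal M}_{k+1}$ and each $F\mapsto F_{\mathbf I}$ is continuous into $C^\infty(\mathcal M_{|\mathbf I|},Z)$ with the $C^\infty$-topology (uniform convergence of all derivatives on compact sets). For an open neighbourhood $Z^*\subset Z$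 of $0$, let $\mathrm{Coh}(\bar{\mathcal M}_{k+1},Z^*)$ be the set of coherent maps $F$ with values in $Z^*$ whose image is contractible in $Z^*$ (the inclusion of the image into $Z^*$ is null-homotopic). For $U\subset\mathcal M_n$ open, let $C_0^\infty(U,Z)$ be the space of smooth maps $\mathcal M_n\to Z$ with compact support contained in $U$, with the $C^\infty$-topology, and let $C_0^\infty(U,Z^*)$ be the subset of maps with values in $Z^*$. **Proposition.** Let $Z$ be a real Banach space and $k\ge 3$. For each stable decomposition $\mathbf I$ of $\{0,\dots,k\}$ with $|\mathbf I|\ge 4$ fix an open subset $U_{\mathbf I}\subset\mathcal M_{|\mathbf I|}$ with compact closure. Then there exist continuous linear maps $$E_{\mathbf I}:C_0^\infty(U_{\mathbf I},Z)\to\mathrm{Coh}(\bar{\mathcal M}_{k+1},Z),$$ one for each such $\mathbf I$, with the following properties: 1. $(E_{\mathbf I}\xi)|_{\mathcal M_{\mathbf I}}=\xi\circ p_{\mathbf I}$ for every $\xi\in C_0^\infty(U_{\mathbf I},Z)$. 2. $E_{\mathbf I}\xi$ and $E_{\mathbf J}\eta$ have disjoint (closed) supports for all $\xi\in C_0^\infty(U_{\mathbf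 I},Z)$ and $\eta\in C_0^\infty(U_{\mathbf J},Z)$ with $\mathbf I\ne\mathbf J$. 3. For every open $Z^*\subset Z$ that contains the origin and is star-shaped with respect to it, every $E_{\mathbf I}$ maps $C_0^\infty(U_{\mathbf I},Z^*)$ to $\mathrm{Coh}(\bar{\mathcal M}_{k+1},Z^*)$. -/

import Mathlib

open Filter Topology Set
open scoped ContDiff UniformConvergence

namespace CoherentMaps

noncomputable section

/-- The Riemann sphere `S² = ℂ ∪ {∞}`. The group `GL (Fin 2) ℂ` acts on it by Möbius
transformations, i.e. by the biholomorphic maps of `S²`. -/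
abbrev Sphere : Type := OnePoint ℂ

/-- The group inducing the Möbius transformations of the sphere. -/
abbrev Moebius : Type := GL (Fin 2) ℂ

/-! ### Smooth curves: the open moduli space `M_n` -/

/-- Configurations of `n` pairwise distinct points on the sphere, topologized as a subspace of
`(S²)ⁿ`. -/
abbrev Conf (n : ℕ) : Type := {z : Fin n → Sphere // Function.Injective z}

/-- Two configurations are equivalent if they differ by a Möbius transformation. -/
def confSetoid (n : ℕ) : Setoid (Conf n) where
  r z w := ∃ g : Moebius, ∀ i, w.1 i = g • z.1 i
  iseqv :=
    { refl := fun z => ⟨1, fun i => (one_smul _ _).symm⟩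
      symm := by
        rintro z w ⟨g, hg⟩
        exact ⟨g⁻¹, fun i => by rw [hg, inv_smul_smul]⟩
      trans := by
        rintro z w v ⟨g, hg⟩ ⟨h, hh⟩
        exact ⟨h * g, fun i => by rw [hh, hg, mul_smul]⟩ }

/-- The moduli space `M_n` of `n` pairwise distinct points on the sphere modulo Möbius
transformations. -/
def M (n : ℕ) : Type := Quotient (confSetoid n)

/-- `M_n` carries the quotient topology. -/
instance (n : ℕ) : TopologicalSpace (M n) :=
  inferInstanceAs (TopologicalSpace (Quotient (confSetoid n)))

/-- The class of a configuration in `M_n`. -/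
def M.mk {n : ℕ} (z : Conf n) : M n := Quotient.mk (confSetoid n) z

/-- Configurations of `n` pairwise distinct points in `ℂ = S² ∖ {∞}`. This is an open subset of
`ℂⁿ` which meets every Möbius orbit. -/
def affConf (n : ℕ) : Set (Fin n → ℂ) := {x | Function.Injective x}

/-- The projection `x ↦ [x]` from the affine configuration space to `M_n`. -/
def affProj {n : ℕ} (x : affConf n) : M n :=
  M.mk ⟨fun i => (x.1 i : Sphere), fun _ _ h => x.2 (OnePoint.coe_injective h)⟩

open Classical in
/-- The pullback of a map on `M_n` to the affine configuration space (set to `0` off that open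
set). -/
def pull {n : ℕ} {Z : Type*} [Zero Z] (ξ : M n → Z) (x : Fin n → ℂ) : Z :=
  if h : x ∈ affConf n then ξ (affProj ⟨x, h⟩) else 0

section Smooth

variable (n : ℕ) (Z : Type*) [NormedAddCommGroup Z] [NormedSpace ℝ Z]

lemma pull_add {n : ℕ} {Z : Type*} [NormedAddCommGroup Z] (ξ η : M n → Z) :
    pull (ξ + η) = pull ξ + pull η := by
  funext x
  by_cases h : x ∈ affConf n <;> simp [pull, h]

lemma pull_smul {n : ℕ} {Z : Type*} [NormedAddCommGroup Z] [NormedSpace ℝ Z] (c : ℝ)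
    (ξ : M n → Z) : pull (c • ξ) = c • pull ξ := by
  funext x
  by_cases h : x ∈ affConf n <;> simp [pull, h]

lemma pull_zero {n : ℕ} {Z : Type*} [NormedAddCommGroup Z] : pull (0 : M n → Z) = 0 := by
  funext x
  by_cases h : x ∈ affConf n <;> simp [pull]

/-- Smooth maps `M_n → Z`. The complex manifold `M_n` is the quotient of the configuration space
by the (for `n ≥ 3` free and proper) action of the Möbius group, so that a map on `M_n` is smooth
iff its pullback under the surjective submersion `affConf n → M_n` is smooth. -/
def smoothSubmodule : Submodule ℝ (M n → Z) where
  carrier := {ξ | ContDiffOn ℝ ∞ (pull ξ) (affConf n)}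
  add_mem' {ξ η} hξ hη := by
    simp only [mem_ofPred_eq, pull_add] at *
    exact hξ.add hη
  zero_mem' := by
    simp only [mem_ofPred_eq, pull_zero]
    exact contDiffOn_const
  smul_mem' c ξ hξ := by
    simp only [mem_ofPred_eq, pull_smul] at *
    exact contDiffOn_const.smul hξ

/-- The space `C^∞(M_n, Z)`. -/
def SmoothMap : Type _ := smoothSubmodule n Z

instance : AddCommGroup (SmoothMap n Z) := inferInstanceAs (AddCommGroup (smoothSubmodule n Z))

instance : Module ℝ (SmoothMap n Z) := inferInstanceAs (Module ℝ (smoothSubmodule n Z))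

variable {n Z}

/-- The underlying map of a smooth map. -/
def SmoothMap.fn (ξ : SmoothMap n Z) : M n → Z := ξ.1

/-- The derivatives of order `m` of (the pullback of) a smooth map, in the space of functions
with the topology of uniform convergence on compact subsets of the configuration space. -/
def SmoothMap.jet (ξ : SmoothMap n Z) (m : ℕ) :
    (Fin n → ℂ) →ᵤ[{K | IsCompact K ∧ K ⊆ affConf n}] ((Fin n → ℂ) [×m]→L[ℝ] Z) :=
  UniformOnFun.ofFun _ (iteratedFDeriv ℝ m (pull ξ.fn))

/-- The `C^∞`-topology: uniform convergence of all derivatives on compact sets. -/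
instance : TopologicalSpace (SmoothMap n Z) :=
  TopologicalSpace.induced (fun ξ m => ξ.jet m) inferInstance

/-- `C_0^∞(U, Z)`: smooth maps on `M_n` whose support is compact and contained in `U`, with the
`C^∞`-topology. -/
def CompactlySupported (U : Set (M n)) (Z : Type*) [NormedAddCommGroup Z] [NormedSpace ℝ Z] :
    Submodule ℝ (SmoothMap n Z) where
  carrier := {ξ | HasCompactSupport ξ.fn ∧ tsupport ξ.fn ⊆ U}
  add_mem' {ξ η} hξ hη :=
    ⟨hξ.1.add hη.1, (tsupport_add ξ.fn η.fn).trans (union_subset hξ.2 hη.2)⟩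
  zero_mem' := by
    have h : (0 : SmoothMap n Z).fn = 0 := rfl
    simp [h, HasCompactSupport, tsupport]
  smul_mem' c ξ hξ := by
    have h : tsupport (c • ξ).fn ⊆ tsupport ξ.fn :=
      closure_mono (Function.support_const_smul_subset c ξ.fn)
    exact ⟨hξ.1.of_isClosed_subset isClosed_closure h, h.trans hξ.2⟩

end Smooth

/-! ### Stable nodal curves -/

/-- A stable nodal curve of genus zero with `N` marked points, modelled over a labelled tree.
The vertices of the tree are the components `S_α = S²`; the point `i` lies on the component
`vert i` at `pt i`, and `node α β` is the point `z_{αβ} ∈ S_α` at which `S_α` is attached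
to `S_β`. -/
structure StableCurve (N : ℕ) where
  V : Type
  finite : Finite V
  graph : SimpleGraph V
  isTree : graph.IsTree
  vert : Fin N → V
  pt : Fin N → Sphere
  node : ∀ α β, graph.Adj α β → Sphere
  /-- On every component the special points are pairwise distinct. -/
  distinct : ∀ α, Function.Injective
    (Sum.elim (fun β : graph.neighborSet α => node α β.1 β.2)
      (fun i : {i : Fin N // vert i = α} => pt i.1))
  /-- Every component carries at least three special points. -/
  stable : ∀ α, 3 ≤ Nat.card (graph.neighborSet α ⊕ {i : Fin N // vert i = α})

namespace StableCurve

variable {N : ℕ}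

/-- The path in the tree from `α` to `β`. -/
def path (z : StableCurve N) (α β : z.V) : z.graph.Walk α β :=
  (z.isTree.existsUnique_path α β).choose

open Classical in
/-- The point `z_{αi}` of `S_α`: the marked point `i` if it lies on `S_α`, and otherwise the
node of `S_α` which leads to the component carrying the marked point `i`. -/
def seen (z : StableCurve N) (α : z.V) (i : Fin N) : Sphere :=
  if h : z.vert i = α then z.pt i
  else z.node α (z.path α (z.vert i)).snd
    (SimpleGraph.Walk.adj_snd (SimpleGraph.Walk.not_nil_of_ne (Ne.symm h)))

/-- Isomorphisms of stable curves: a tree isomorphism together with a Möbius transformation on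
every component, compatible with all marked points and nodes. -/
def Iso (z w : StableCurve N) : Prop :=
  ∃ (τ : z.graph ≃g w.graph) (φ : z.V → Moebius),
    (∀ i, w.vert i = τ (z.vert i)) ∧
    (∀ i, w.pt i = φ (z.vert i) • z.pt i) ∧
    ∀ α β (h : z.graph.Adj α β), w.node (τ α) (τ β) (τ.map_adj_iff.2 h) = φ α • z.node α β h

lemma node_congr (z : StableCurve N) {α α' β β' : z.V} (hα : α = α') (hβ : β = β')
    (h : z.graph.Adj α β) (h' : z.graph.Adj α' β') : z.node α β h = z.node α' β' h' := by
  subst hα hβ; rfl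

/-- Stable curves up to isomorphism. -/
instance setoid (N : ℕ) : Setoid (StableCurve N) where
  r := Iso
  iseqv :=
    { refl := fun z => ⟨SimpleGraph.Iso.refl, fun _ => 1, fun _ => rfl,
        fun i => (one_smul _ _).symm, fun α β h => (one_smul _ _).symm⟩
      symm := by
        rintro z w ⟨τ, φ, hv, hp, hn⟩
        refine ⟨τ.symm, fun β => (φ (τ.symm β))⁻¹, fun i => ?_, fun i => ?_, fun α β h => ?_⟩
        · rw [hv]; exact (τ.symm_apply_apply _).symm
        · rw [hp, hv]
          have e : τ.symm (τ (z.vert i)) = z.vert i := τ.symm_apply_apply _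
          change _ = (φ (τ.symm (τ (z.vert i))))⁻¹ • _
          rw [e, inv_smul_smul]
        · have h' := hn (τ.symm α) (τ.symm β) (τ.symm.map_adj_iff.2 h)
          rw [w.node_congr (τ.apply_symm_apply α) (τ.apply_symm_apply β) _ h] at h'
          rw [h', inv_smul_smul]
      trans := by
        rintro z w v ⟨τ, φ, hv, hp, hn⟩ ⟨σ, ψ, hv', hp', hn'⟩
        refine ⟨τ.trans σ, fun α => ψ (τ α) * φ α, fun i => ?_, fun i => ?_, fun α β h => ?_⟩
        · rw [hv', hv]; rfl
        · rw [hp', hp, hv, mul_smul]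
        · rw [mul_smul, ← hn α β h, ← hn' _ _ (τ.map_adj_iff.2 h)]
          rfl }

lemma path_isPath (z : StableCurve N) (α β : z.V) : (z.path α β).IsPath :=
  (z.isTree.existsUnique_path α β).choose_spec.1

lemma path_unique (z : StableCurve N) {α β : z.V} (p : z.graph.Walk α β) (hp : p.IsPath) :
    p = z.path α β :=
  (z.isTree.existsUnique_path α β).choose_spec.2 p hp

lemma seen_of_ne (z : StableCurve N) {α : z.V} {i : Fin N} (h : z.vert i ≠ α) {β : z.V}
    (p : z.graph.Walk α (z.vert i)) (hp : p.IsPath) (hβ : p.snd = β) (hadj : z.graph.Adj α β) :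
    z.seen α i = z.node α β hadj := by
  rw [seen, dif_neg h]
  apply node_congr _ rfl
  rw [← z.path_unique p hp, hβ]

/-- The points `z_{αi}` are transformed by an isomorphism of curves as they should. -/
lemma seen_iso {z w : StableCurve N} {τ : z.graph ≃g w.graph} {φ : z.V → Moebius}
    (hv : ∀ i, w.vert i = τ (z.vert i)) (hp : ∀ i, w.pt i = φ (z.vert i) • z.pt i)
    (hn : ∀ α β (h : z.graph.Adj α β),
      w.node (τ α) (τ β) (τ.map_adj_iff.2 h) = φ α • z.node α β h) (α : z.V) (i : Fin N) :
    w.seen (τ α) i = φ α • z.seen α i := by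
  by_cases h : z.vert i = α
  · rw [seen, dif_pos (by rw [hv, h]), seen, dif_pos h, hp, h]
  · have hw : w.vert i ≠ τ α := by
      rw [hv]; exact fun e => h (τ.injective e)
    have hadj : z.graph.Adj α (z.path α (z.vert i)).snd :=
      SimpleGraph.Walk.adj_snd (SimpleGraph.Walk.not_nil_of_ne (Ne.symm h))
    rw [seen_of_ne z h _ (z.path_isPath _ _) rfl hadj, ← hn _ _ hadj]
    refine seen_of_ne w hw
      (((z.path α (z.vert i)).map τ.toHom).copy rfl (hv i).symm) ?_ ?_ _
    · rw [SimpleGraph.Walk.isPath_copy]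
      exact (z.path_isPath _ _).map τ.injective
    · simp only [SimpleGraph.Walk.snd, SimpleGraph.Walk.getVert_copy,
        SimpleGraph.Walk.getVert_map]
      rfl

/-- A map of the underlying labelled trees which collapses subtrees, surjectively: edges go to
edges or vertices, all fibres are (nonempty) subtrees, and labels are preserved. -/
def IsTreeHom (z w : StableCurve N) (f : z.V → w.V) : Prop :=
  (∀ α β, z.graph.Adj α β → f α = f β ∨ w.graph.Adj (f α) (f β)) ∧
  (∀ v, (z.graph.induce (f ⁻¹' {v})).Connected) ∧
  ∀ i, f (z.vert i) = w.vert i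

/-- Gromov convergence of a sequence `z` of stable curves to the stable curve `w`: for large `ν`
there are surjective tree homomorphisms `f ν` from the tree of `w` to that of `z ν` and Möbius
transformations `φ ν α` such that
* (rescaling) for an edge `αβ` collapsed by `f ν` for a subsequence of the `ν`, along that
  subsequence `(φ ν α)⁻¹ ∘ φ ν β` converges to `w_{αβ}`, uniformly on compact subsets
  of `S² ∖ {w_{βα}}`;
* (nodal points) for an edge `αβ` not collapsed by `f ν` for a subsequence of the `ν`, along that
  subsequence the rescaled nodes converge to `w_{αβ}`;
* (marked points) the rescaled marked points converge. -/
def GromovConverges (z : ℕ → StableCurve N) (w : StableCurve N) : Prop :=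
  ∃ (f : ∀ ν, w.V → (z ν).V) (φ : ℕ → w.V → Moebius),
    (∀ᶠ ν in atTop, IsTreeHom w (z ν) (f ν)) ∧
    (∀ α β (h : w.graph.Adj α β), ∀ K : Set Sphere, IsCompact K → w.node β α h.symm ∉ K →
      ∀ O ∈ 𝓝 (w.node α β h), ∀ᶠ ν in atTop, f ν α = f ν β →
        ∀ x ∈ K, (φ ν α)⁻¹ • φ ν β • x ∈ O) ∧
    (∀ α β (h : w.graph.Adj α β), ∀ O ∈ 𝓝 (w.node α β h), ∀ᶠ ν in atTop,
      ∀ h' : (z ν).graph.Adj (f ν α) (f ν β),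
        (φ ν α)⁻¹ • (z ν).node (f ν α) (f ν β) h' ∈ O) ∧
    ∀ i, Tendsto (fun ν => (φ ν (w.vert i))⁻¹ • (z ν).pt i) atTop (𝓝 (w.pt i))

end StableCurve

/-- The Deligne-Mumford space of stable genus zero curves with `N` marked points. -/
def MBar (N : ℕ) : Type 1 := Quotient (StableCurve.setoid N)

/-- The isomorphism class of a stable curve. -/
def MBar.mk {N : ℕ} (z : StableCurve N) : MBar N := Quotient.mk (StableCurve.setoid N) z

/-- The Gromov topology: a set is open iff every sequence of stable curves which Gromov converges
to a point of the set eventually lies in the set. -/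
instance (N : ℕ) : TopologicalSpace (MBar N) where
  IsOpen O := ∀ (z : ℕ → StableCurve N) (w : StableCurve N), StableCurve.GromovConverges z w →
    MBar.mk w ∈ O → ∀ᶠ ν in atTop, MBar.mk (z ν) ∈ O
  isOpen_univ := fun _ _ _ _ => Eventually.of_forall fun _ => mem_univ _
  isOpen_inter := fun _ _ hs ht z w h hw => (hs z w h hw.1).and (ht z w h hw.2)
  isOpen_sUnion := by
    rintro S hS z w h ⟨s, hs, hw⟩
    exact (hS s hs z w h hw).mono fun ν hν => ⟨s, hs, hν⟩

/-! ### Stable decompositions and the associated strata -/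

variable {k : ℕ}

open Classical in
/-- The minimal elements of the classes of an equivalence relation on `{0,…,k}`. -/
def minima (r : Setoid (Fin (k + 1))) : Finset (Fin (k + 1)) :=
  Finset.univ.filter fun i => ∀ j, r i j → i ≤ j

/-- A stable decomposition `(I_0,…,I_ℓ)` of `{0,…,k}`, given as the equivalence relation whose
classes are the `I_j`: `I_0 = {0}` and the number of classes is at least three. -/
@[ext]
structure StableDecomp (k : ℕ) where
  rel : Setoid (Fin (k + 1))
  zero_class : ∀ i, rel i 0 → i = 0
  three_le : 3 ≤ (minima rel).card

namespace StableDecomp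

/-- The number `|I| = ℓ + 1` of classes. -/
def size (I : StableDecomp k) : ℕ := (minima I.rel).card

/-- The minima `0 = i_0 < i_1 < … < i_ℓ` of the classes, in increasing order. -/
def rep (I : StableDecomp k) : Fin I.size ↪o Fin (k + 1) := (minima I.rel).orderEmbOfFin rfl

lemma mem_minima {r : Setoid (Fin (k + 1))} {i : Fin (k + 1)} :
    i ∈ minima r ↔ ∀ j, r i j → i ≤ j := by
  simp [minima]

lemma rep_injective_class (I : StableDecomp k) {a b : Fin I.size}
    (h : I.rel (I.rep a) (I.rep b)) : a = b := by
  have ha := mem_minima.1 ((minima I.rel).orderEmbOfFin_mem rfl a)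
  have hb := mem_minima.1 ((minima I.rel).orderEmbOfFin_mem rfl b)
  exact I.rep.injective (le_antisymm (ha _ h) (hb _ (I.rel.symm h)))

lemma exists_rep (I : StableDecomp k) (i : Fin (k + 1)) : ∃ a, I.rel (I.rep a) i := by
  classical
  obtain ⟨m, hm, hmin⟩ := Finset.exists_min_image (Finset.univ.filter fun j => I.rel j i) id
    ⟨i, by simp⟩
  have hmi : I.rel m i := by simpa using hm
  have hmem : m ∈ minima I.rel := mem_minima.2 fun j hj => hmin j (by
    simpa using I.rel.trans (I.rel.symm hj) hmi)
  have : m ∈ Set.range ((minima I.rel).orderEmbOfFin rfl) := by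
    rw [Finset.range_orderEmbOfFin]; exact hmem
  obtain ⟨a, ha⟩ := this
  exact ⟨a, by have e : I.rep a = m := ha
               rw [e]; exact hmi⟩

end StableDecomp

/-- The equivalence relation `i ∼ j ↔ z_{α₀ i} = z_{α₀ j}` on the labels, where `S_{α₀}` is the
component carrying the marked point `0`. -/
def StableCurve.rootRel (z : StableCurve (k + 1)) : Setoid (Fin (k + 1)) :=
  Setoid.ker (z.seen (z.vert 0))

/-- The relation of a point of the Deligne-Mumford space. -/
def MBar.rootRel : MBar (k + 1) → Setoid (Fin (k + 1)) :=
  Quotient.lift StableCurve.rootRel (by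
    rintro z w ⟨τ, φ, hv, hp, hn⟩
    ext i j
    change _ = _ ↔ _ = _
    rw [hv 0, StableCurve.seen_iso hv hp hn, StableCurve.seen_iso hv hp hn, smul_left_cancel_iff])

/-- The stratum `M_I` of all curves whose decomposition is `I`. -/
def stratum (I : StableDecomp k) : Set (MBar (k + 1)) := {x | x.rootRel = I.rel}

/-- The special points `z_{α₀ i_0}, …, z_{α₀ i_ℓ}` on the component `S_{α₀}` carrying the marked
point `0`, in the order given by the minima `i_0 < … < i_ℓ`. -/
def rootConf (I : StableDecomp k) (z : StableCurve (k + 1)) (hz : z.rootRel = I.rel) :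
    Conf I.size :=
  ⟨fun a => z.seen (z.vert 0) (I.rep a), fun a b hab =>
    I.rep_injective_class (by rw [← hz]; exact hab)⟩

/-- The projection `p_I : M_I → M_{|I|}`, sending a curve to the special points on the component
carrying the marked point `0`. -/
def proj (I : StableDecomp k) (x : stratum I) : M I.size :=
  M.mk (rootConf I (Quotient.out x.1) (by
    have h : MBar.rootRel x.1 = I.rel := x.2
    rw [← Quotient.out_eq x.1] at h
    exact h))

/-- The projection can be computed from any curve representing the given point. -/
lemma proj_mk (I : StableDecomp k) (z : StableCurve (k + 1)) (hz : z.rootRel = I.rel) :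
    proj I ⟨MBar.mk z, hz⟩ = M.mk (rootConf I z hz) := by
  obtain ⟨τ, φ, hv, hp, hn⟩ := Quotient.exact (Quotient.out_eq (MBar.mk z))
  refine Quotient.sound ⟨φ (StableCurve.vert _ 0), fun a => ?_⟩
  simp only [rootConf]
  rw [hv 0, StableCurve.seen_iso hv hp hn]

/-! ### Surjectivity of the projections

Every point of `M_{|I|}` is the image under `p_I` of a curve whose tree is a star: the central
component carries the given configuration, and every class with more than one element is placed on
an additional component. -/

namespace StableDecomp

variable (I : StableDecomp k)

/-- The index of the class of `i`. -/
def cls (i : Fin (k + 1)) : Fin I.size := (I.exists_rep i).choose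

lemma rep_cls (i : Fin (k + 1)) : I.rel (I.rep (I.cls i)) i := (I.exists_rep i).choose_spec

lemma cls_rep (a : Fin I.size) : I.cls (I.rep a) = a := I.rep_injective_class (I.rep_cls _)

lemma cls_eq_iff {i j : Fin (k + 1)} : I.cls i = I.cls j ↔ I.rel i j := by
  constructor
  · intro h
    have h1 := I.rep_cls i
    rw [h] at h1
    exact I.rel.trans (I.rel.symm h1) (I.rep_cls j)
  · intro h
    exact I.rep_injective_class
      (I.rel.trans (I.rel.trans (I.rep_cls i) h) (I.rel.symm (I.rep_cls j)))

/-- Classes with more than one element. -/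
def Big (a : Fin I.size) : Prop := ∃ i, i ≠ I.rep a ∧ I.cls i = a

lemma eq_of_not_big {i j : Fin (k + 1)} (h : ¬ I.Big (I.cls i)) (hij : I.cls i = I.cls j) :
    i = j := by
  have aux : ∀ m, I.cls m = I.cls i → m = I.rep (I.cls i) := fun m hm => by
    by_contra hne
    exact h ⟨m, hne, hm⟩
  rw [aux i rfl, aux j hij.symm]

open Classical in
/-- The component of the star on which the marked point `i` is placed. -/
def starVert (i : Fin (k + 1)) : Option {a : Fin I.size // I.Big a} :=
  if h : I.Big (I.cls i) then some ⟨I.cls i, h⟩ else none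

open Classical in
/-- The position of the marked point `i` on its component. -/
def starPt (x : Conf I.size) (i : Fin (k + 1)) : Sphere :=
  if I.Big (I.cls i) then ((i.1 : ℂ) : Sphere) else x.1 (I.cls i)

/-- The nodes of the star. -/
def starNode (x : Conf I.size) : Option {a : Fin I.size // I.Big a} →
    Option {a : Fin I.size // I.Big a} → Sphere
  | none, some a => x.1 a.1
  | _, _ => OnePoint.infty

lemma starVert_eq_none {i : Fin (k + 1)} : I.starVert i = none ↔ ¬ I.Big (I.cls i) := by
  by_cases h : I.Big (I.cls i) <;> simp [starVert, h]

lemma starVert_eq_some {i : Fin (k + 1)} {a : {a : Fin I.size // I.Big a}} :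
    I.starVert i = some a ↔ I.cls i = a.1 := by
  by_cases h : I.Big (I.cls i)
  · simp [starVert, h, Subtype.ext_iff]
  · simp only [starVert, h, dif_neg, not_false_eq_true, reduceCtorEq, false_iff]
    rintro e
    exact h (e ▸ a.2)

/-- The star-shaped curve with given special points on the central component. -/
def starCurve (x : Conf I.size) : StableCurve (k + 1) where
  V := Option {a : Fin I.size // I.Big a}
  finite := inferInstance
  graph := SimpleGraph.starGraph none
  isTree := SimpleGraph.isTree_starGraph none
  vert := I.starVert
  pt := I.starPt x
  node α β _ := I.starNode x α β
  distinct := by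
    rintro (_ | a)
    · rintro (⟨β, hβ⟩ | ⟨i, hi⟩) (⟨γ, hγ⟩ | ⟨j, hj⟩) h
      · rcases β with _ | b
        · simp at hβ
        rcases γ with _ | c
        · simp at hγ
        have : b.1 = c.1 := x.2 h
        have : b = c := Subtype.ext this
        subst this; rfl
      · rcases β with _ | b
        · simp at hβ
        rw [starVert_eq_none] at hj
        simp only [Sum.elim_inl, Sum.elim_inr, starPt, hj, if_false] at h
        have : b.1 = I.cls j := x.2 h
        exact absurd b.2 (this ▸ hj)
      · rcases γ with _ | b
        · simp at hγ
        rw [starVert_eq_none] at hi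
        simp only [Sum.elim_inl, Sum.elim_inr, starPt, hi, if_false] at h
        have : I.cls i = b.1 := x.2 h
        exact absurd b.2 (this ▸ hi)
      · rw [starVert_eq_none] at hi hj
        simp only [Sum.elim_inr, starPt, hi, hj, if_false] at h
        have := I.eq_of_not_big hi (x.2 h)
        subst this; rfl
    · rintro (⟨β, hβ⟩ | ⟨i, hi⟩) (⟨γ, hγ⟩ | ⟨j, hj⟩) h
      · have hb : β = none := by simpa using (SimpleGraph.starGraph_adj.1 hβ).2
        have hc : γ = none := by simpa using (SimpleGraph.starGraph_adj.1 hγ).2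
        subst hb hc; rfl
      · rw [starVert_eq_some] at hj
        have hj' : I.Big (I.cls j) := hj ▸ a.2
        simp [starPt, starNode, hj'] at h
      · rw [starVert_eq_some] at hi
        have hi' : I.Big (I.cls i) := hi ▸ a.2
        simp [starPt, starNode, hi'] at h
      · rw [starVert_eq_some] at hi hj
        have hi' : I.Big (I.cls i) := hi ▸ a.2
        have hj' : I.Big (I.cls j) := hj ▸ a.2
        simp only [Sum.elim_inr, starPt, hi', hj', if_true] at h
        have : i = j := Fin.ext (by exact_mod_cast OnePoint.coe_injective h)
        subst this; rfl
  stable := by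
    classical
    rintro (_ | a)
    · let f : Fin I.size → (SimpleGraph.starGraph
          (none : Option {a : Fin I.size // I.Big a})).neighborSet none ⊕
          {i : Fin (k + 1) // I.starVert i = none} := fun a =>
        if h : I.Big a then Sum.inl ⟨some ⟨a, h⟩, by simp⟩
        else Sum.inr ⟨I.rep a, by rw [starVert_eq_none, cls_rep]; exact h⟩
      have hf : Function.Injective f := by
        intro a b hab
        by_cases ha : I.Big a <;> by_cases hb : I.Big b <;>
          simp only [f, ha, hb, dif_pos, dif_neg, not_false_eq_true, reduceCtorEq, Sum.inl.injEq,
            Sum.inr.injEq, Subtype.mk.injEq, Option.some.injEq] at hab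
        · exact hab
        · exact I.rep.injective hab
      have := Nat.card_le_card_of_injective f hf
      rw [Nat.card_fin] at this
      exact I.three_le.trans this
    · obtain ⟨i, hne, hi⟩ := a.2
      let f : Fin 3 → (SimpleGraph.starGraph
          (none : Option {a : Fin I.size // I.Big a})).neighborSet (some a) ⊕
          {i : Fin (k + 1) // I.starVert i = some a} :=
        ![Sum.inl ⟨none, by simp⟩, Sum.inr ⟨i, by rw [starVert_eq_some]; exact hi⟩,
          Sum.inr ⟨I.rep a.1, by rw [starVert_eq_some, cls_rep]⟩]
      have hf : Function.Injective f := by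
        intro p q hpq
        fin_cases p <;> fin_cases q <;> simp [f, hne, hne.symm] at hpq ⊢
      have := Nat.card_le_card_of_injective f hf
      rwa [Nat.card_fin] at this

/-- The central component of the star. -/
def center (x : Conf I.size) : (I.starCurve x).V := (none : Option {a : Fin I.size // I.Big a})

lemma starCurve_seen (x : Conf I.size) (i : Fin (k + 1)) :
    (I.starCurve x).seen (I.center x) i = x.1 (I.cls i) := by
  by_cases h : I.Big (I.cls i)
  · have hv : I.starVert i = some ⟨I.cls i, h⟩ := I.starVert_eq_some.2 rfl
    have hne : I.starVert i ≠ none := by rw [hv]; exact Option.some_ne_none _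
    have hadj : (I.starCurve x).graph.Adj (I.center x) ((I.starCurve x).vert i) :=
      SimpleGraph.starGraph_adj.2 ⟨hne.symm, Or.inl rfl⟩
    refine (StableCurve.seen_of_ne _ hne hadj.toWalk ?_ rfl hadj).trans ?_
    · exact SimpleGraph.Walk.IsPath.of_adj hadj
    · change I.starNode x none (I.starVert i) = _
      rw [hv]; rfl
  · have hv : (I.starCurve x).vert i = I.center x := I.starVert_eq_none.2 h
    refine (dif_pos hv).trans ?_
    change I.starPt x i = _
    simp [starPt, h]

lemma starCurve_vert_zero (x : Conf I.size) : (I.starCurve x).vert 0 = I.center x := by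
  refine I.starVert_eq_none.2 ?_
  rintro ⟨i, hne, hi⟩
  have h1 := I.zero_class i (I.cls_eq_iff.1 hi)
  have h2 := I.zero_class _ (I.rep_cls 0)
  exact hne (h1.trans h2.symm)

lemma starCurve_rootRel (x : Conf I.size) : (I.starCurve x).rootRel = I.rel := by
  ext i j
  change _ = _ ↔ _
  rw [starCurve_vert_zero, starCurve_seen, starCurve_seen, x.2.eq_iff, cls_eq_iff]

end StableDecomp

lemma proj_surjective (I : StableDecomp k) : Function.Surjective (proj I) := by
  intro y
  obtain ⟨x, rfl⟩ : ∃ x, M.mk x = y := Quotient.exists_rep y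
  refine ⟨⟨MBar.mk (I.starCurve x), I.starCurve_rootRel x⟩, ?_⟩
  rw [proj_mk]
  congr 1
  ext a
  simp only [rootConf]
  rw [I.starCurve_vert_zero, I.starCurve_seen, I.cls_rep]

/-! ### Coherent maps -/

section Coherent

variable (k) (Z : Type*) [NormedAddCommGroup Z] [NormedSpace ℝ Z]

variable {k Z} in
/-- A continuous map `F` on the Deligne-Mumford space with `k + 1` marked points is coherent if
(a) it vanishes in a neighbourhood of the strata `M_I` with `|I| = 3`, and
(b) on each stratum `M_I` with `|I| ≥ 4` it is of the form `F_I ∘ p_I` with `F_I` smooth. -/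
def IsCoherent (F : C(MBar (k + 1), Z)) : Prop :=
  (∀ I : StableDecomp k, I.size = 3 → ∀ᶠ x in 𝓝ˢ (stratum I), F x = 0) ∧
  ∀ I : StableDecomp k, 4 ≤ I.size →
    ∃ G : SmoothMap I.size Z, ∀ x : stratum I, F x = G.fn (proj I x)

/-- Coherent maps form a linear subspace of the continuous maps. -/
def cohSubmodule : Submodule ℝ C(MBar (k + 1), Z) where
  carrier := {F | IsCoherent F}
  add_mem' {F F'} hF hF' := by
    refine ⟨fun I hI => ?_, fun I hI => ?_⟩
    · filter_upwards [hF.1 I hI, hF'.1 I hI] with x h h'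
      simp [h, h']
    · obtain ⟨G, hG⟩ := hF.2 I hI
      obtain ⟨G', hG'⟩ := hF'.2 I hI
      refine ⟨G + G', fun x => ?_⟩
      rw [ContinuousMap.add_apply, hG, hG']
      rfl
  zero_mem' := ⟨fun I _ => Eventually.of_forall fun _ => rfl, fun I _ => ⟨0, fun _ => rfl⟩⟩
  smul_mem' c F hF := by
    refine ⟨fun I hI => ?_, fun I hI => ?_⟩
    · filter_upwards [hF.1 I hI] with x h
      simp [h]
    · obtain ⟨G, hG⟩ := hF.2 I hI
      refine ⟨c • G, fun x => ?_⟩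
      rw [ContinuousMap.smul_apply, hG]
      rfl

/-- The space of coherent maps on the Deligne-Mumford space with `k + 1` marked points. -/
def Coh : Type _ := cohSubmodule k Z

instance : AddCommGroup (Coh k Z) := inferInstanceAs (AddCommGroup (cohSubmodule k Z))

instance : Module ℝ (Coh k Z) := inferInstanceAs (Module ℝ (cohSubmodule k Z))

/-- The stable decompositions `I` with `|I| ≥ 4`. -/
abbrev LargeDecomp : Type := {I : StableDecomp k // 4 ≤ I.size}

variable {k Z}

/-- The underlying map of a coherent map. -/
def Coh.fn (F : Coh k Z) : C(MBar (k + 1), Z) := F.1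

/-- The smooth map `F_I` with `F = F_I ∘ p_I` on `M_I`. -/
def Coh.comp (F : Coh k Z) (I : LargeDecomp k) : SmoothMap I.1.size Z := (F.2.2 I.1 I.2).choose

lemma Coh.fn_eq_comp (F : Coh k Z) (I : LargeDecomp k) (x : stratum I.1) :
    F.fn x = (F.comp I).fn (proj I.1 x) :=
  (F.2.2 I.1 I.2).choose_spec x

/-- The map `F_I` is unique. -/
lemma Coh.comp_unique (F : Coh k Z) (I : LargeDecomp k) (G : SmoothMap I.1.size Z)
    (h : ∀ x : stratum I.1, F.fn x = G.fn (proj I.1 x)) : F.comp I = G := by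
  apply Subtype.ext
  funext y
  obtain ⟨x, rfl⟩ := proj_surjective I.1 y
  exact (F.fn_eq_comp I x).symm.trans (h x)

/-- The space of coherent maps carries the `C^0`-topology (uniform convergence) on the
Deligne-Mumford space and the `C^∞`-topology on each stratum `M_I` via the projection `p_I`. -/
instance : TopologicalSpace (Coh k Z) :=
  TopologicalSpace.induced
    (fun F => ((UniformFun.ofFun F.fn : MBar (k + 1) →ᵤ Z), fun I : LargeDecomp k => F.comp I))
    inferInstance

/-- `F` is a coherent map to the subset `Zs` of `Z`: it is coherent, it takes values in `Zs`, and
its image is contractible in `Zs`. -/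
def Coh.MapsInto (F : Coh k Z) (Zs : Set Z) : Prop :=
  ∃ h : Set.range F.fn ⊆ Zs,
    (⟨Set.inclusion h, continuous_inclusion h⟩ : C(Set.range F.fn, Zs)).Nullhomotopic

end Coherent

end

end CoherentMaps

open CoherentMaps

namespace CoherentMaps

noncomputable section

/-! ### Möbius transformations of the sphere -/

/-! Everything is read off from the root configuration c_i = z_{α₀i} on S², which is defined up to
one Möbius transformation. Gromov convergence makes these configurations converge after rescaling
(`StableCurve.tendsto_seen`). Hence a Möbius invariant function that is continuous at admissible
configurations (no other point meets c_0, and the other points do not all coincide) descends to a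
continuous function on the Deligne–Mumford space (`MBar.continuous_ofRoot`).

The basic invariant is `gap`: put c_0 at ∞, which leaves only affine changes of coordinate, and
divide |c_i - c_j|² by the sum of all such squares. For i, j ≠ 0 it vanishes exactly when c_i = c_j.
The cutoff of I kills configurations with a gap ≥ ε/2 inside a class or a gap ≤ ε between two
classes other than {0}. The extension of ξ is this cutoff times ξ evaluated at the points c_{i_0},
…, c_{i_ℓ}.

Two different decompositions disagree about some pair of labels, whose gap is ≤ ε/2 on one support
and ≥ ε on the other (`disjoint_tsupport_extMap`). If J has fewer classes than I, it joins a pair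
that I separates, so the extension vanishes near M_J (`extMap_eventually_eq_zero`); this covers |J|
= 3. On an arbitrary M_J the extension is a smooth cutoff times ξ with substituted arguments, or
zero if two representatives of I become equal (`pull_stratumMap`, `stratumMap_eq_zero`). The Leibniz
rule then yields continuity in the C^∞-topology (`exists_bound_iteratedFDeriv_smul_comp`).

Compactness of the closures of the U_I, together with finiteness of the set of decompositions, gives
one ε for which every cutoff is 1 on the part of M_I over U_I (`exists_gap_lower_bound`).
Compactness also turns C^∞ convergence into uniform convergence. Finally, the cutoffs take values in
[0,1], so star-shaped sets are preserved and images contract radially to 0. -/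

lemma tendsto_coe_infty {α : Type*} {l : Filter α} {f : α → ℂ}
    (hf : Tendsto f l (Bornology.cobounded ℂ)) :
    Tendsto (fun x => (f x : Sphere)) l (𝓝 OnePoint.infty) := by
  refine OnePoint.tendsto_coe_infty.comp ?_
  rwa [Metric.cobounded_eq_cocompact, ← coclosedCompact_eq_cocompact] at hf

/-- Such a transformation fixes ∞ and is a nonconstant affine map of ℂ, hence proper. -/
lemma continuous_smul_of_upper (g : Moebius) (hg : g 1 0 = 0) :
    Continuous fun x : Sphere => g • x := by
  have hdet := g.det_ne_zero
  rw [Matrix.det_fin_two, hg, mul_zero, sub_zero] at hdet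
  have h11 : g 1 1 ≠ 0 := right_ne_zero_of_mul hdet
  have h00 : g 0 0 ≠ 0 := left_ne_zero_of_mul hdet
  have hcoe : ∀ x : ℂ, g • (x : Sphere) = (((g 0 0 * x + g 0 1) / g 1 1 : ℂ) : Sphere) := by
    intro x
    rw [OnePoint.smul_some_eq_ite, hg, zero_mul, zero_add, if_neg h11]
  rw [OnePoint.continuous_iff]
  constructor
  · rw [OnePoint.smul_infty_eq_ite, if_pos hg]
    simp only [hcoe]
    apply tendsto_coe_infty
    rw [coclosedCompact_eq_cocompact, ← Metric.cobounded_eq_cocompact]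
    have h1 : Tendsto (fun x : ℂ => g 0 0 * x) (Bornology.cobounded ℂ) (Bornology.cobounded ℂ) :=
      tendsto_mul_left_cobounded h00
    have h2 := (tendsto_add_const_cobounded (g 0 1)).comp h1
    have h3 := (tendsto_mul_right_cobounded (inv_ne_zero h11)).comp h2
    simpa only [div_eq_mul_inv, Function.comp_def] using h3
  · simp only [hcoe]
    exact OnePoint.continuous_coe.comp (by fun_prop)

/-- The inversion `x ↦ 1 / x` of the sphere. -/
def inversion : Moebius := Matrix.GeneralLinearGroup.mkOfDetNeZero !![0, 1; 1, 0] (by simp)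

lemma inversion_smul_coe {x : ℂ} (hx : x ≠ 0) :
    inversion • (x : Sphere) = ((x⁻¹ : ℂ) : Sphere) := by
  rw [OnePoint.smul_some_eq_ite]
  simp [inversion, Matrix.GeneralLinearGroup.mkOfDetNeZero, hx]

lemma inversion_smul_zero : inversion • ((0 : ℂ) : Sphere) = OnePoint.infty := by
  rw [OnePoint.smul_some_eq_ite]
  simp [inversion, Matrix.GeneralLinearGroup.mkOfDetNeZero]

lemma inversion_smul_infty : inversion • (OnePoint.infty : Sphere) = ((0 : ℂ) : Sphere) := by
  rw [OnePoint.smul_infty_eq_ite]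
  simp [inversion, Matrix.GeneralLinearGroup.mkOfDetNeZero]

lemma continuous_inversion_smul : Continuous fun x : Sphere => inversion • x := by
  rw [OnePoint.continuous_iff]
  constructor
  · rw [inversion_smul_infty, coclosedCompact_eq_cocompact, ← Metric.cobounded_eq_cocompact]
    have h : Tendsto (fun x : ℂ => ((x⁻¹ : ℂ) : Sphere)) (Bornology.cobounded ℂ)
        (𝓝 ((0 : ℂ) : Sphere)) :=
      (OnePoint.continuous_coe.tendsto (0 : ℂ)).comp tendsto_inv₀_cobounded
    refine h.congr' ?_
    filter_upwards [Bornology.isBounded_def.1 (Bornology.isBounded_singleton (x := (0 : ℂ)))]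
      with x hx
    exact (inversion_smul_coe hx).symm
  · rw [continuous_iff_continuousAt]
    intro x
    by_cases hx : x = 0
    · subst hx
      rw [continuousAt_iff_punctured_nhds, inversion_smul_zero]
      refine (tendsto_coe_infty tendsto_inv₀_nhdsNE_zero).congr' ?_
      filter_upwards [self_mem_nhdsWithin] with x hx
      exact (inversion_smul_coe hx).symm
    · have h : ContinuousAt (fun x : ℂ => ((x⁻¹ : ℂ) : Sphere)) x :=
        OnePoint.continuous_coe.continuousAt.comp (continuousAt_inv₀ hx)
      refine h.congr ?_
      filter_upwards [eventually_ne_nhds hx] with y hy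
      exact (inversion_smul_coe hy).symm

instance : ContinuousConstSMul Moebius Sphere where
  continuous_const_smul g := by
    by_cases hg : g 1 0 = 0
    · exact continuous_smul_of_upper g hg
    have hdet := g.det_ne_zero
    rw [Matrix.det_fin_two] at hdet
    -- With c = `g 1 0` nonzero, (ax+b)/(cx+d) = a/c + ((bc-ad)/c) · 1/(cx+d): an affine map, the
    -- inversion, and another affine map.
    let A : Moebius := Matrix.GeneralLinearGroup.mkOfDetNeZero
      !![(g 0 1 * g 1 0 - g 0 0 * g 1 1) / g 1 0, g 0 0 / g 1 0; 0, 1] (by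
        rw [Matrix.det_fin_two_of, mul_zero, sub_zero, mul_one]
        refine div_ne_zero (fun h => hdet ?_) hg
        linear_combination -h)
    let B : Moebius := Matrix.GeneralLinearGroup.mkOfDetNeZero
      !![g 1 0, g 1 1; 0, 1] (by simpa using hg)
    have h : g = A * inversion * B := by
      ext i j
      fin_cases i <;> fin_cases j <;>
        simp [A, B, inversion, Matrix.GeneralLinearGroup.mkOfDetNeZero] <;>
        field_simp <;> ring
    have hA : Continuous fun x : Sphere => A • x :=
      continuous_smul_of_upper A (by simp [A, Matrix.GeneralLinearGroup.mkOfDetNeZero])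
    have hB : Continuous fun x : Sphere => B • x :=
      continuous_smul_of_upper B (by simp [B, Matrix.GeneralLinearGroup.mkOfDetNeZero])
    rw [h]
    simp only [mul_smul]
    exact hA.comp (continuous_inversion_smul.comp hB)

/-- Finitely many points of the sphere can be moved into `ℂ` by a Möbius transformation. -/
lemma exists_smul_eq_coe {ι : Type*} [Finite ι] (c : ι → Sphere) :
    ∃ (g : Moebius) (y : ι → ℂ), ∀ i, g • c i = (y i : Sphere) := by
  have hfin : ((fun x : ℂ => (x : Sphere)) ⁻¹' range c).Finite :=
    (finite_range c).preimage OnePoint.coe_injective.injOn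
  -- The map x ↦ 1/(x - p) sends only p to ∞, so any p different from the finitely many given points
  -- will do.
  obtain ⟨p, hp⟩ := hfin.infinite_compl.nonempty
  let g : Moebius := Matrix.GeneralLinearGroup.mkOfDetNeZero !![0, 1; 1, -p] (by simp)
  have hg : ∀ i, ∃ y : ℂ, g • c i = (y : Sphere) := by
    intro i
    induction h : c i using OnePoint.rec with
    | infty =>
      rw [OnePoint.smul_infty_eq_ite, if_neg (by
        simp [g, Matrix.GeneralLinearGroup.mkOfDetNeZero])]
      exact ⟨_, rfl⟩
    | coe x =>
      rw [OnePoint.smul_some_eq_ite, if_neg]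
      · exact ⟨_, rfl⟩
      · intro h0
        have : x = p := by
          simp [g, Matrix.GeneralLinearGroup.mkOfDetNeZero] at h0
          linear_combination h0
        exact hp ⟨i, by rw [h, this]⟩
  choose y hy using hg
  exact ⟨g, y, hy⟩

/-! ### Brackets and gaps -/

/-- The first homogeneous coordinate of a point of the sphere. -/
def num (p : Sphere) : ℂ := OnePoint.elim p 1 fun x => x

/-- The second homogeneous coordinate of a point of the sphere. -/
def den (p : Sphere) : ℂ := OnePoint.elim p 0 fun _ => 1

@[simp] lemma num_coe (x : ℂ) : num (x : Sphere) = x := rfl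
@[simp] lemma den_coe (x : ℂ) : den (x : Sphere) = 1 := rfl
@[simp] lemma num_infty : num OnePoint.infty = 1 := rfl
@[simp] lemma den_infty : den OnePoint.infty = 0 := rfl

/-- The determinant of the homogeneous coordinates of two points of the sphere. -/
def bracket (p q : Sphere) : ℂ := num p * den q - den p * num q

@[simp] lemma bracket_coe (x y : ℂ) : bracket (x : Sphere) (y : Sphere) = x - y := by
  simp [bracket]

/-- The homogeneous coordinates are normalized to (x, 1) or (1, 0), so they transform by the matrix
only up to a nonzero scalar. -/
lemma exists_factor (g : Moebius) (p : Sphere) : ∃ a : ℂ, a ≠ 0 ∧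
    num (g • p) = a * (g 0 0 * num p + g 0 1 * den p) ∧
    den (g • p) = a * (g 1 0 * num p + g 1 1 * den p) := by
  have hdet := g.det_ne_zero
  rw [Matrix.det_fin_two] at hdet
  induction p using OnePoint.rec with
  | infty =>
    rw [OnePoint.smul_infty_eq_ite]
    split_ifs with h
    · have h0 : g 0 0 ≠ 0 := by
        intro h0
        simp [h, h0] at hdet
      exact ⟨(g 0 0)⁻¹, inv_ne_zero h0, by simp [h0], by simp [h]⟩
    · exact ⟨(g 1 0)⁻¹, inv_ne_zero h, by simp [div_eq_inv_mul], by simp [h]⟩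
  | coe x =>
    rw [OnePoint.smul_some_eq_ite]
    split_ifs with h
    · have h0 : g 0 0 * x + g 0 1 ≠ 0 := by
        intro h0
        by_cases hc : g 1 0 = 0
        · have hd : g 1 1 = 0 := by simpa [hc] using h
          simp [hc, hd] at hdet
        · apply hdet
          refine mul_left_cancel₀ hc ?_
          linear_combination (g 1 0 * g 0 0) * h - (g 1 0) ^ 2 * h0
      exact ⟨(g 0 0 * x + g 0 1)⁻¹, inv_ne_zero h0, by simp [h0], by simp [h]⟩
    · exact ⟨(g 1 0 * x + g 1 1)⁻¹, inv_ne_zero h, by simp [div_eq_inv_mul], by simp [h]⟩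

lemma exists_bracket_smul (g : Moebius) : ∃ (D : ℂ) (a : Sphere → ℂ), D ≠ 0 ∧ (∀ p, a p ≠ 0) ∧
    ∀ p q, bracket (g • p) (g • q) = D * a p * a q * bracket p q := by
  choose a ha hn hd using exists_factor g
  refine ⟨g 0 0 * g 1 1 - g 0 1 * g 1 0, a, ?_, ha, fun p q => ?_⟩
  · rw [← Matrix.det_fin_two]
    exact g.det_ne_zero
  · simp only [bracket, hn, hd]
    ring

lemma bracket_ne_zero {p q : Sphere} (h : p ≠ q) : bracket p q ≠ 0 := by
  induction p using OnePoint.rec with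
  | infty =>
    induction q using OnePoint.rec with
    | infty => exact absurd rfl h
    | coe y => simp [bracket]
  | coe x =>
    induction q using OnePoint.rec with
    | infty => simp [bracket]
    | coe y =>
      rw [bracket_coe, sub_ne_zero]
      exact fun e => h (by rw [e])

lemma bracket_self (p : Sphere) : bracket p p = 0 := by
  simp [bracket, mul_comm]

section Gap

variable {k : ℕ}

/-- In a coordinate with `c 0 = ∞`, unique up to affine transformations, this is the difference
of `c i` and `c j` (up to a common factor). -/
def diff (c : Fin (k + 1) → Sphere) (i j : Fin (k + 1)) : ℂ :=
  bracket (c i) (c j) / (bracket (c i) (c 0) * bracket (c j) (c 0))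

/-- The total squared size of a configuration. -/
def spread (c : Fin (k + 1) → Sphere) : ℝ := ∑ i, ∑ j, Complex.normSq (diff c i j)

/-- The normalized squared distance of the points `c i` and `c j`, in a coordinate of the sphere
for which `c 0 = ∞`. -/
def gap (c : Fin (k + 1) → Sphere) (i j : Fin (k + 1)) : ℝ :=
  Complex.normSq (diff c i j) / spread c

/-- The scalars belonging to `c i` and `c j` cancel between numerator and denominator; only those of
`c 0` and the determinant survive, and they do not depend on i and j. -/
lemma exists_diff_smul (g : Moebius) (c : Fin (k + 1) → Sphere) :
    ∃ r : ℂ, r ≠ 0 ∧ ∀ i j, diff (fun i => g • c i) i j = r * diff c i j := by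
  obtain ⟨D, a, hD, ha, h⟩ := exists_bracket_smul g
  refine ⟨(D * a (c 0) ^ 2)⁻¹, inv_ne_zero (mul_ne_zero hD (pow_ne_zero 2 (ha _))),
    fun i j => ?_⟩
  have e : D * a (c i) * a (c j) ≠ 0 := mul_ne_zero (mul_ne_zero hD (ha _)) (ha _)
  simp only [diff, h]
  rw [show D * a (c i) * a (c 0) * bracket (c i) (c 0) *
      (D * a (c j) * a (c 0) * bracket (c j) (c 0)) = (D * a (c i) * a (c j)) *
      ((D * a (c 0) ^ 2) * (bracket (c i) (c 0) * bracket (c j) (c 0))) by ring,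
    mul_div_mul_left _ _ e, div_mul_eq_div_div, div_eq_mul_inv (bracket (c i) (c j)),
    mul_comm (bracket (c i) (c j)), mul_div_assoc]

lemma gap_smul (g : Moebius) (c : Fin (k + 1) → Sphere) (i j : Fin (k + 1)) :
    gap (fun i => g • c i) i j = gap c i j := by
  obtain ⟨r, hr, h⟩ := exists_diff_smul g c
  have hr' : Complex.normSq r ≠ 0 := by simpa using hr
  simp only [gap, spread, h, map_mul, ← Finset.mul_sum]
  exact mul_div_mul_left _ _ hr'

/-- The configurations which occur on the component of a stable curve carrying the marked
point `0`. -/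
def Admissible (c : Fin (k + 1) → Sphere) : Prop :=
  (∀ i, i ≠ 0 → c i ≠ c 0) ∧ ∃ i j, i ≠ 0 ∧ j ≠ 0 ∧ c i ≠ c j

lemma Admissible.smul {c : Fin (k + 1) → Sphere} (h : Admissible c) (g : Moebius) :
    Admissible fun i => g • c i := by
  refine ⟨fun i hi e => h.1 i hi (MulAction.injective g e), ?_⟩
  obtain ⟨i, j, hi, hj, hij⟩ := h.2
  exact ⟨i, j, hi, hj, fun e => hij (MulAction.injective g e)⟩

lemma diff_ne_zero {c : Fin (k + 1) → Sphere} (hc : ∀ i, i ≠ 0 → c i ≠ c 0) {i j : Fin (k + 1)}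
    (hi : i ≠ 0) (hj : j ≠ 0) (hij : c i ≠ c j) : diff c i j ≠ 0 :=
  div_ne_zero (bracket_ne_zero hij)
    (mul_ne_zero (bracket_ne_zero (hc i hi)) (bracket_ne_zero (hc j hj)))

lemma spread_pos {c : Fin (k + 1) → Sphere} (hc : Admissible c) : 0 < spread c := by
  obtain ⟨i, j, hi, hj, hij⟩ := hc.2
  have h0 : ∀ i, 0 ≤ ∑ j, Complex.normSq (diff c i j) := fun i =>
    Finset.sum_nonneg fun _ _ => Complex.normSq_nonneg _
  refine Finset.sum_pos' (fun i _ => h0 i) ⟨i, Finset.mem_univ _, ?_⟩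
  refine Finset.sum_pos' (fun _ _ => Complex.normSq_nonneg _) ⟨j, Finset.mem_univ _, ?_⟩
  exact Complex.normSq_pos.2 (diff_ne_zero hc.1 hi hj hij)

lemma gap_pos {c : Fin (k + 1) → Sphere} (hc : Admissible c) {i j : Fin (k + 1)}
    (hi : i ≠ 0) (hj : j ≠ 0) (hij : c i ≠ c j) : 0 < gap c i j :=
  div_pos (Complex.normSq_pos.2 (diff_ne_zero hc.1 hi hj hij)) (spread_pos hc)

lemma gap_eq_zero {c : Fin (k + 1) → Sphere} {i j : Fin (k + 1)} (hij : c i = c j) :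
    gap c i j = 0 := by
  simp [gap, diff, hij, bracket_self]

/-- The denominator contains the bracket of `c 0` with itself, and division by zero gives 0. Pairs
involving the label 0 thus contribute nothing to `spread`. -/
lemma diff_zero_left (c : Fin (k + 1) → Sphere) (j : Fin (k + 1)) : diff c 0 j = 0 := by
  simp [diff, bracket_self]

lemma diff_zero_right (c : Fin (k + 1) → Sphere) (j : Fin (k + 1)) : diff c j 0 = 0 := by
  simp [diff, bracket_self]

/-- The affine configurations, as points of the sphere. -/
def toSphere {n : ℕ} (y : Fin n → ℂ) : Fin n → Sphere := fun i => (y i : Sphere)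

lemma contDiffAt_diff {y : Fin (k + 1) → ℂ} (hy : ∀ i, i ≠ 0 → y i ≠ y 0) (i j : Fin (k + 1)) :
    ContDiffAt ℝ ∞ (fun y => diff (toSphere y) i j) y := by
  by_cases hi : i = 0
  · subst hi
    simp only [diff_zero_left]
    exact contDiffAt_const
  by_cases hj : j = 0
  · subst hj
    simp only [diff_zero_right]
    exact contDiffAt_const
  simp only [diff, toSphere, bracket_coe]
  have hp : ∀ i : Fin (k + 1), ContDiffAt ℝ ∞ (fun y : Fin (k + 1) → ℂ => y i) y := fun i =>
    (contDiff_apply ℝ ℂ i).contDiffAt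
  simp only [div_eq_mul_inv]
  refine ((hp i).sub (hp j)).mul ((((hp i).sub (hp 0)).mul ((hp j).sub (hp 0))).inv ?_)
  exact mul_ne_zero (sub_ne_zero.2 (hy i hi)) (sub_ne_zero.2 (hy j hj))

lemma contDiff_normSq : ContDiff ℝ ∞ Complex.normSq := by
  have : (Complex.normSq : ℂ → ℝ) = fun z => ‖z‖ ^ 2 := by
    funext z
    exact Complex.normSq_eq_norm_sq z
  rw [this]
  exact contDiff_norm_sq ℝ

lemma contDiffAt_gap {y : Fin (k + 1) → ℂ} (hy : Admissible (toSphere y)) (i j : Fin (k + 1)) :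
    ContDiffAt ℝ ∞ (fun y => gap (toSphere y) i j) y := by
  have hy' : ∀ i, i ≠ 0 → y i ≠ y 0 := fun i hi e => hy.1 i hi (by simp [toSphere, e])
  have h : ∀ i j, ContDiffAt ℝ ∞ (fun y => Complex.normSq (diff (toSphere y) i j)) y :=
    fun i j => contDiff_normSq.contDiffAt.comp y (contDiffAt_diff hy' i j)
  refine (h i j).div ?_ (spread_pos hy).ne'
  exact ContDiffAt.sum fun i _ => ContDiffAt.sum fun j _ => h i j

lemma isOpenEmbedding_toSphere (n : ℕ) :
    IsOpenEmbedding (toSphere : (Fin n → ℂ) → Fin n → Sphere) :=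
  IsOpenEmbedding.piMap fun _ => OnePoint.isOpenEmbedding_coe

/-- By invariance the points may first be moved into ℂ, where `gap` is smooth and where the affine
tuples form an open subset of all tuples. -/
lemma continuousAt_gap {c : Fin (k + 1) → Sphere} (hc : Admissible c) (i j : Fin (k + 1)) :
    ContinuousAt (fun c => gap c i j) c := by
  obtain ⟨g, y, hy⟩ := exists_smul_eq_coe c
  have hgc : (fun i => g • c i) = toSphere y := funext hy
  have hy' : Admissible (toSphere y) := hgc ▸ hc.smul g
  have h1 : ContinuousAt (fun c => gap c i j) (toSphere y) :=
    (isOpenEmbedding_toSphere _).continuousAt_iff.1 (contDiffAt_gap hy' i j).continuousAt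
  rw [← hgc] at h1
  have h2 : ContinuousAt (fun (c : Fin (k + 1) → Sphere) i => g • c i) c :=
    (continuous_pi fun i => (continuous_apply i).const_smul g).continuousAt
  have h3 := ContinuousAt.comp (f := fun (c : Fin (k + 1) → Sphere) i => g • c i) h1 h2
  simpa only [Function.comp_def, gap_smul] using h3

end Gap

/-! ### Branches of stable curves -/

namespace StableCurve

variable {N : ℕ}

lemma seen_vert (z : StableCurve N) (i : Fin N) : z.seen (z.vert i) i = z.pt i :=
  dif_pos rfl

/-- If the marked point `i` lies on the branch at `α` starting with `β`, it is seen from `α` at the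
node leading to `β`. -/
lemma seen_eq_node (z : StableCurve N) {α β : z.V} (h : z.graph.Adj α β) {i : Fin N}
    (q : z.graph.Walk β (z.vert i)) (hq : α ∉ q.support) : z.seen α i = z.node α β h := by
  classical
  have hne : z.vert i ≠ α := fun e => hq (e ▸ q.end_mem_support)
  refine z.seen_of_ne hne (SimpleGraph.Walk.cons h q.bypass) ?_ (by simp) h
  exact q.bypass_isPath.cons fun hm => hq (q.support_bypass_subset_support hm)

/-- A walk which avoids `α` is mapped to a walk avoiding the image of `α`, provided that its first
edge is an edge at `α` which is not collapsed. -/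
lemma IsTreeHom.exists_walk {z w : StableCurve N} {f : z.V → w.V} (hf : IsTreeHom z w f)
    {α β : z.V} (h : z.graph.Adj α β) (hne : f α ≠ f β) {v : z.V} (q : z.graph.Walk β v)
    (hq : α ∉ q.support) : ∃ q' : w.graph.Walk (f β) (f v), f α ∉ q'.support := by
  classical
  -- If γ on the walk had the same image as α, the connected fibre would contain a path from α to γ.
  -- Paths in a tree are unique, so this path passes through β, and the edge from α to β would be
  -- collapsed.
  have havoid : ∀ γ ∈ q.support, f γ ≠ f α := by
    intro γ hγ e
    obtain ⟨p⟩ := (hf.2.1 (f α)).preconnected ⟨α, rfl⟩ ⟨γ, e⟩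
    let p' : z.graph.Walk α γ := p.map (SimpleGraph.Embedding.induce _).toHom
    have hp' : ∀ δ ∈ p'.support, f δ = f α := by
      intro δ hδ
      obtain ⟨⟨δ', hδ'⟩, -, rfl⟩ := List.mem_map.1 (SimpleGraph.Walk.support_map _ p ▸ hδ)
      exact hδ'
    let q' : z.graph.Walk α γ := SimpleGraph.Walk.cons h (q.takeUntil γ hγ).bypass
    have hq' : q'.IsPath := (SimpleGraph.Walk.bypass_isPath _).cons fun hm =>
      hq (q.support_takeUntil_subset_support hγ (SimpleGraph.Walk.support_bypass_subset_support _ hm))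
    have heq : q' = p'.bypass :=
      (z.path_unique q' hq').trans (z.path_unique _ p'.bypass_isPath).symm
    have hβ : β ∈ q'.support := by simp [q']
    rw [heq] at hβ
    exact hne (hp' β (p'.support_bypass_subset_support hβ)).symm
  clear hq h hne
  induction q with
  | nil => exact ⟨SimpleGraph.Walk.nil, by simpa using (havoid _ (by simp)).symm⟩
  | @cons a b v hab q ih =>
    obtain ⟨q', hq'⟩ := ih fun γ hγ => havoid γ (by simp [hγ])
    have ha : f a ≠ f α := havoid a (by simp)
    rcases hf.1 a b hab with e | e
    · rw [e]
      exact ⟨q', hq'⟩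
    · exact ⟨SimpleGraph.Walk.cons e q', by simp [hq', ha.symm]⟩

/-- The marked points on the branch at `α` starting with `β` are not seen from `β` at the node
leading back to `α`. -/
lemma seen_ne_node (z : StableCurve N) {α β : z.V} (h : z.graph.Adj α β) {i : Fin N}
    (q : z.graph.Walk β (z.vert i)) (hq : q.IsPath) (hα : α ∉ q.support) :
    z.seen β i ≠ z.node β α h.symm := by
  by_cases hi : z.vert i = β
  · rw [seen, dif_pos hi]
    intro e
    have := @z.distinct β (Sum.inr ⟨i, hi⟩) (Sum.inl ⟨α, h.symm⟩) e
    simp at this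
  · have hnil : ¬ q.Nil := SimpleGraph.Walk.not_nil_of_ne (Ne.symm hi)
    rw [z.seen_of_ne hi q hq rfl (q.adj_snd hnil)]
    intro e
    have := @z.distinct β (Sum.inl ⟨q.snd, q.adj_snd hnil⟩) (Sum.inl ⟨α, h.symm⟩) e
    have hs : q.snd = α := congrArg Subtype.val (Sum.inl.inj this)
    exact hα (hs ▸ q.getVert_mem_support 1)

/-- If a sequence of curves Gromov converges, then the rescaled points `z_{αi}` converge. -/
lemma tendsto_seen {z : ℕ → StableCurve N} {w : StableCurve N} {f : ∀ ν, w.V → (z ν).V}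
    {φ : ℕ → w.V → Moebius} (hf : ∀ᶠ ν in atTop, IsTreeHom w (z ν) (f ν))
    (hr : ∀ α β (h : w.graph.Adj α β), ∀ K : Set Sphere, IsCompact K → w.node β α h.symm ∉ K →
      ∀ O ∈ 𝓝 (w.node α β h), ∀ᶠ ν in atTop, f ν α = f ν β →
        ∀ x ∈ K, (φ ν α)⁻¹ • φ ν β • x ∈ O)
    (hn : ∀ α β (h : w.graph.Adj α β), ∀ O ∈ 𝓝 (w.node α β h), ∀ᶠ ν in atTop,
      ∀ h' : (z ν).graph.Adj (f ν α) (f ν β),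
        (φ ν α)⁻¹ • (z ν).node (f ν α) (f ν β) h' ∈ O)
    (hm : ∀ i, Tendsto (fun ν => (φ ν (w.vert i))⁻¹ • (z ν).pt i) atTop (𝓝 (w.pt i)))
    (α : w.V) (i : Fin N) :
    Tendsto (fun ν => (φ ν α)⁻¹ • (z ν).seen (f ν α) i) atTop (𝓝 (w.seen α i)) := by
  -- Induction along the path from α to the component carrying i; the convergence at β is
  -- transported across the edge from α to β.
  suffices H : ∀ {α v : w.V} (p : w.graph.Walk α v), p.IsPath → v = w.vert i →
      Tendsto (fun ν => (φ ν α)⁻¹ • (z ν).seen (f ν α) i) atTop (𝓝 (w.seen α i)) from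
    H (w.path α (w.vert i)) (w.path_isPath _ _) rfl
  clear α
  intro α v p hp hv
  induction p with
  | nil =>
    subst hv
    rw [seen_vert]
    refine (hm i).congr' ?_
    filter_upwards [hf] with ν hν
    rw [hν.2.2 i, seen_vert]
  | @cons α β v h q ih =>
    subst hv
    rw [SimpleGraph.Walk.cons_isPath_iff] at hp
    have ih := ih hp.1 rfl
    have hne := w.seen_ne_node h q hp.1 hp.2
    rw [w.seen_eq_node h q hp.2]
    -- The limit point on β is not the node leading back to α, so it has a compact neighbourhood
    -- avoiding that node, on which the rescaling condition applies.
    obtain ⟨K, hK, hKc, hKn⟩ := local_compact_nhds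
      (isOpen_compl_singleton.mem_nhds (show w.seen β i ∈ {w.node β α h.symm}ᶜ from hne))
    intro O hO
    have hiK : ∀ᶠ ν in atTop, (φ ν β)⁻¹ • (z ν).seen (f ν β) i ∈ K := ih hK
    change ∀ᶠ ν in atTop, (φ ν α)⁻¹ • (z ν).seen (f ν α) i ∈ O
    filter_upwards [hf, hr α β h K hKn (fun hmem => hKc hmem rfl) O hO, hn α β h O hO, hiK]
      with ν hν hrν hnν hiν
    -- A collapsed edge is governed by the rescaling condition; otherwise the branch survives and i
    -- is seen at the node, whose convergence is the nodal condition.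
    by_cases e : f ν α = f ν β
    · have := hrν e _ hiν
      rw [smul_inv_smul, ← e] at this
      exact this
    · have hadj := (hν.1 α β h).resolve_left e
      obtain ⟨q', hq'⟩ := hν.exists_walk h e q hp.2
      have := (z ν).seen_eq_node hadj (i := i) (q'.copy rfl (hν.2.2 i))
        (by rwa [SimpleGraph.Walk.support_copy])
      rw [this]
      exact hnν hadj

/-- Every branch of a stable curve carries a marked point. -/
lemma exists_seen_eq_node (z : StableCurve N) {α β : z.V} (h : z.graph.Adj α β) :
    ∃ i, z.seen α i = z.node α β h := by
  classical
  have := z.finite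
  let S : Set z.V := {γ | ∃ q : z.graph.Walk β γ, q.IsPath ∧ α ∉ q.support}
  have hS : S.Nonempty := ⟨β, SimpleGraph.Walk.nil, by simp, by simpa using h.ne⟩
  -- A component of the branch farthest from β. Without marked points on it, stability provides
  -- three neighbours, hence one off the path, which would be farther away.
  obtain ⟨γ, ⟨q, hq, hα⟩, hmax⟩ :=
    S.toFinite.exists_maximalFor (fun γ => (z.path β γ).length) S hS
  by_contra hno
  have hno' : ∀ i, z.vert i ≠ γ := by
    rintro i rfl
    exact hno ⟨i, z.seen_eq_node h q hα⟩
  have hemp : IsEmpty {i : Fin N // z.vert i = γ} := ⟨fun i => hno' i.1 i.2⟩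
  have hcard := z.stable γ
  have hfin : Finite (z.graph.neighborSet γ) := Subtype.finite
  rw [Nat.card_sum, Nat.card_of_isEmpty (α := {i : Fin N // z.vert i = γ}), add_zero,
    Nat.card_coe_set_eq] at hcard
  have hp' : (SimpleGraph.Walk.cons h q).IsPath := hq.cons hα
  obtain ⟨δ, hδ, hδne⟩ : ∃ δ ∈ z.graph.neighborSet γ,
      δ ≠ (SimpleGraph.Walk.cons h q).penultimate := by
    obtain ⟨a, ha, b, hb, hab⟩ := (one_lt_ncard (toFinite (z.graph.neighborSet γ))).1 (by omega)
    by_cases e : a = (SimpleGraph.Walk.cons h q).penultimate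
    · exact ⟨b, hb, fun e' => hab (e.trans e'.symm)⟩
    · exact ⟨a, ha, e⟩
  have hδ' : z.graph.Adj γ δ := hδ
  have hnot : δ ∉ (SimpleGraph.Walk.cons h q).support := fun hm =>
    hδne (z.isTree.isAcyclic.eq_penultimate_of_adj_end hp' hδ' hm)
  rw [SimpleGraph.Walk.support_cons, List.mem_cons, not_or] at hnot
  have hqδ : (q.concat hδ').IsPath := hq.concat hnot.2 hδ'
  have hlt : (z.path β γ).length < (z.path β δ).length := by
    rw [← z.path_unique q hq, ← z.path_unique _ hqδ, SimpleGraph.Walk.length_concat]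
    exact Nat.lt_succ_self _
  refine absurd (hmax (j := δ) ⟨q.concat hδ', hqδ, ?_⟩ hlt.le) (not_le.2 hlt)
  rw [SimpleGraph.Walk.support_concat]
  simp [hα, Ne.symm hnot.1]

/-- From the component of j, the label i is seen at a node or at another marked point, and special
points on a component are distinct. -/
lemma seen_ne_pt (z : StableCurve N) {i j : Fin N} (hij : i ≠ j) :
    z.seen (z.vert j) i ≠ z.seen (z.vert j) j := by
  rw [seen_vert]
  by_cases hi : z.vert i = z.vert j
  · rw [seen, dif_pos hi]
    intro e
    have := @z.distinct (z.vert j) (Sum.inr ⟨i, hi⟩) (Sum.inr ⟨j, rfl⟩) e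
    simp only [Sum.inr.injEq, Subtype.mk.injEq] at this
    exact hij this
  · have hnil := SimpleGraph.Walk.not_nil_of_ne (p := z.path (z.vert j) (z.vert i)) (Ne.symm hi)
    rw [z.seen_of_ne hi _ (z.path_isPath _ _) rfl (SimpleGraph.Walk.adj_snd hnil)]
    intro e
    have := @z.distinct (z.vert j) (Sum.inl ⟨_, SimpleGraph.Walk.adj_snd hnil⟩)
      (Sum.inr ⟨j, rfl⟩) e
    simp at this

/-- The points `z_{α₀ i}` on the component carrying the marked point `0`. -/
def root {k : ℕ} (z : StableCurve (k + 1)) : Fin (k + 1) → Sphere := z.seen (z.vert 0)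

lemma root_iso {k : ℕ} {z w : StableCurve (k + 1)} (h : Iso z w) :
    ∃ g : Moebius, w.root = fun i => g • z.root i := by
  obtain ⟨τ, φ, hv, hp, hn⟩ := h
  refine ⟨φ (z.vert 0), funext fun i => ?_⟩
  rw [root, hv 0, seen_iso hv hp hn, root]

/-- The root component has two special points besides the marked point 0, and each is the position
of some label because every branch carries a marked point. -/
lemma admissible_root {k : ℕ} (z : StableCurve (k + 1)) : Admissible z.root := by
  refine ⟨fun i hi => z.seen_ne_pt hi, ?_⟩
  set α := z.vert 0 with hα
  let T := z.graph.neighborSet α ⊕ {i : Fin (k + 1) // z.vert i = α}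
  let sp : T → Sphere := Sum.elim (fun β => z.node α β.1 β.2) fun i => z.pt i.1
  have hseen : ∀ s : T, ∃ i, z.root i = sp s := by
    rintro (⟨β, hβ⟩ | ⟨i, hi⟩)
    · exact z.exists_seen_eq_node hβ
    · exact ⟨i, by rw [root, ← hα, seen, dif_pos hi]; rfl⟩
  let s0 : T := Sum.inr ⟨0, rfl⟩
  have := z.finite
  have hT : 3 ≤ (univ : Set T).ncard := by
    rw [ncard_univ]
    exact z.stable α
  have h2 : 1 < ({s0}ᶜ : Set T).ncard := by
    have := ncard_add_ncard_compl ({s0} : Set T)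
    rw [ncard_singleton, ← ncard_univ] at this
    omega
  obtain ⟨s, hs, t, ht, hst⟩ := (one_lt_ncard (toFinite ({s0}ᶜ : Set T))).1 h2
  obtain ⟨i, hi⟩ := hseen s
  obtain ⟨j, hj⟩ := hseen t
  have h0 : z.root 0 = sp s0 := z.seen_vert 0
  refine ⟨i, j, ?_, ?_, fun e => hst (z.distinct α (hi.symm.trans (e.trans hj)))⟩
  · rintro rfl
    exact hs (z.distinct α (hi.symm.trans h0))
  · rintro rfl
    exact ht (z.distinct α (hj.symm.trans h0))

/-- Gromov convergence implies convergence of the points on the root component, up to Möbius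
transformations. -/
lemma GromovConverges.tendsto_root {k : ℕ} {z : ℕ → StableCurve (k + 1)} {w : StableCurve (k + 1)}
    (h : GromovConverges z w) : ∃ g : ℕ → Moebius,
      Tendsto (fun ν i => g ν • (z ν).root i) atTop (𝓝 w.root) := by
  obtain ⟨f, φ, hf, hr, hn, hm⟩ := h
  refine ⟨fun ν => (φ ν (w.vert 0))⁻¹, tendsto_pi_nhds.2 fun i => ?_⟩
  refine (tendsto_seen hf hr hn hm (w.vert 0) i).congr' ?_
  filter_upwards [hf] with ν hν
  rw [hν.2.2 0]
  rfl

end StableCurve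

namespace MBar

variable {k : ℕ} {X : Type*}

/-- A Möbius invariant function of the points on the component carrying the marked point `0`, as a
function on the Deligne-Mumford space. -/
def ofRoot (H : (Fin (k + 1) → Sphere) → X) (hH : ∀ (g : Moebius) c, H (fun i => g • c i) = H c) :
    MBar (k + 1) → X :=
  Quotient.lift (fun z => H z.root) (by
    intro z w h
    obtain ⟨g, hg⟩ := StableCurve.root_iso h
    rw [hg, hH])

/-- Open sets are tested on Gromov convergent sequences; the rescalings that make the root
configurations converge are absorbed by invariance, and the limits are admissible. -/
lemma continuous_ofRoot [TopologicalSpace X] {H : (Fin (k + 1) → Sphere) → X}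
    (hH : ∀ (g : Moebius) c, H (fun i => g • c i) = H c)
    (hc : ∀ c, Admissible c → ContinuousAt H c) : Continuous (ofRoot H hH) := by
  refine continuous_def.2 fun O hO z w h hw => ?_
  obtain ⟨g, hg⟩ := h.tendsto_root
  have := ((hc _ w.admissible_root).tendsto.comp hg).eventually (hO.mem_nhds hw)
  filter_upwards [this] with ν hν
  simp only [Function.comp_apply, hH] at hν
  exact hν

end MBar

/-! ### The moduli space of smooth curves -/

section Moduli

variable {n : ℕ}

lemma injective_toSphere {y : Fin n → ℂ} :
    Function.Injective (toSphere y) ↔ Function.Injective y :=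
  OnePoint.coe_injective.of_comp_iff y

lemma isOpen_affConf : IsOpen (affConf n) := by
  have : affConf n = ⋂ i : Fin n, ⋂ j : Fin n, {x | x i = x j → i = j} := by
    ext x
    simp [affConf, Function.Injective]
  rw [this]
  refine isOpen_iInter_of_finite fun i => isOpen_iInter_of_finite fun j => ?_
  by_cases h : i = j
  · simp [h]
  · simp only [h, imp_false]
    exact isOpen_ne_fun (continuous_apply i) (continuous_apply j)

/-- The action of Möbius transformations on configurations. -/
def Conf.smul (g : Moebius) (c : Conf n) : Conf n :=
  ⟨fun i => g • c.1 i, fun _ _ h => c.2 (MulAction.injective g h)⟩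

lemma Conf.continuous_smul (g : Moebius) : Continuous (Conf.smul g : Conf n → Conf n) :=
  Continuous.subtype_mk (continuous_pi fun i =>
    ((continuous_apply i).comp continuous_subtype_val).const_smul g) _

lemma M.mk_smul (g : Moebius) (c : Conf n) : M.mk (c.smul g) = M.mk c :=
  Quotient.sound ⟨g⁻¹, fun i => (inv_smul_smul g (c.1 i)).symm⟩

lemma M.mk_eq_iff {c d : Conf n} : M.mk c = M.mk d ↔ ∃ g : Moebius, c.smul g = d := by
  constructor
  · intro h
    obtain ⟨g, hg⟩ := Quotient.exact h
    exact ⟨g, Subtype.ext (funext fun i => (hg i).symm)⟩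
  · rintro ⟨g, rfl⟩
    exact (M.mk_smul g c).symm

lemma M.continuous_mk : Continuous (M.mk : Conf n → M n) := continuous_quotient_mk'

/-- An affine configuration as a configuration on the sphere. -/
def affToConf (x : affConf n) : Conf n := ⟨toSphere x.1, injective_toSphere.2 x.2⟩

lemma affProj_eq (x : affConf n) : affProj x = M.mk (affToConf x) := rfl

lemma isOpenMap_affToConf : IsOpenMap (affToConf : affConf n → Conf n) := by
  intro O hO
  have h : affToConf '' O = Subtype.val ⁻¹' (toSphere '' (Subtype.val '' O)) := by
    ext c
    constructor
    · rintro ⟨x, hx, rfl⟩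
      exact ⟨x.1, ⟨x, hx, rfl⟩, rfl⟩
    · rintro ⟨_, ⟨x, hx, rfl⟩, hc⟩
      exact ⟨x, hx, Subtype.ext hc⟩
  rw [h]
  exact ((isOpenEmbedding_toSphere n).isOpenMap _
    (isOpen_affConf.isOpenMap_subtype_val _ hO)).preimage continuous_subtype_val

lemma exists_smul_eq_affToConf (c : Conf n) : ∃ (g : Moebius) (x : affConf n),
    c.smul g = affToConf x := by
  obtain ⟨g, y, hy⟩ := exists_smul_eq_coe c.1
  have h : (c.smul g).1 = toSphere y := funext hy
  exact ⟨g, ⟨y, injective_toSphere.1 (h ▸ (c.smul g).2)⟩, Subtype.ext h⟩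

lemma surjective_affProj : Function.Surjective (affProj : affConf n → M n) := by
  intro u
  obtain ⟨c, rfl⟩ : ∃ c, M.mk c = u := Quotient.exists_rep u
  obtain ⟨g, x, hx⟩ := exists_smul_eq_affToConf c
  exact ⟨x, by rw [affProj_eq, ← hx, M.mk_smul]⟩

lemma continuous_affProj : Continuous (affProj : affConf n → M n) := by
  refine M.continuous_mk.comp (Continuous.subtype_mk ?_ _)
  exact (isOpenEmbedding_toSphere n).continuous.comp continuous_subtype_val

/-- The saturation of an open set of affine configurations is the union of its preimages under the
Möbius maps. -/
lemma isOpenMap_affProj : IsOpenMap (affProj : affConf n → M n) := by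
  intro O hO
  change IsOpen (M.mk ⁻¹' (affProj '' O))
  have h : (M.mk ⁻¹' (affProj '' O) : Set (Conf n)) =
      ⋃ g : Moebius, Conf.smul g ⁻¹' (affToConf '' O) := by
    ext c
    simp only [mem_preimage, mem_image, mem_iUnion, affProj_eq]
    constructor
    · rintro ⟨x, hx, e⟩
      obtain ⟨g, hg⟩ := M.mk_eq_iff.1 e.symm
      exact ⟨g, x, hx, hg.symm⟩
    · rintro ⟨g, x, hx, e⟩
      exact ⟨x, hx, by rw [e, M.mk_smul]⟩
  rw [h]
  exact isOpen_iUnion fun g => (isOpenMap_affToConf O hO).preimage (Conf.continuous_smul g)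

/-- Compact subsets of the moduli space are images of compact sets of affine configurations. -/
lemma exists_isCompact_affConf {K : Set (M n)} (hK : IsCompact K) :
    ∃ L : Set (Fin n → ℂ), IsCompact L ∧ L ⊆ affConf n ∧
      ∀ u ∈ K, ∃ x : affConf n, x.1 ∈ L ∧ affProj x = u := by
  have : LocallyCompactSpace (affConf n) := isOpen_affConf.locallyCompactSpace
  have hloc : ∀ x : affConf n, ∃ C : Set (affConf n), IsCompact C ∧ C ∈ 𝓝 x := fun x =>
    exists_compact_mem_nhds x
  choose C hC hCn using hloc
  obtain ⟨t, ht⟩ := hK.elim_finite_subcover (fun x => affProj '' interior (C x))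
    (fun x => isOpenMap_affProj _ isOpen_interior) (by
      intro u _
      obtain ⟨x, rfl⟩ := surjective_affProj u
      exact mem_iUnion.2 ⟨x, x, mem_interior_iff_mem_nhds.2 (hCn x), rfl⟩)
  refine ⟨Subtype.val '' ⋃ x ∈ t, C x,
    (t.isCompact_biUnion fun x _ => hC x).image continuous_subtype_val, ?_, fun u hu => ?_⟩
  · rintro _ ⟨x, -, rfl⟩
    exact x.2
  · obtain ⟨x, hx, y, hy, rfl⟩ := mem_iUnion₂.1 (ht hu)
    exact ⟨y, ⟨y, mem_iUnion₂.2 ⟨x, hx, interior_subset hy⟩, rfl⟩, rfl⟩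

end Moduli

/-! ### Smooth maps on the moduli space -/

section SmoothMaps

variable {n : ℕ} {Z : Type*} [NormedAddCommGroup Z]

open Classical in
/-- A map on the moduli space, as a function of all tuples of points on the sphere
(set to `0` if the points are not distinct). -/
def evalConf (ξ : M n → Z) (c : Fin n → Sphere) : Z :=
  if h : Function.Injective c then ξ (M.mk ⟨c, h⟩) else 0

lemma evalConf_of_injective (ξ : M n → Z) {c : Fin n → Sphere} (h : Function.Injective c) :
    evalConf ξ c = ξ (M.mk ⟨c, h⟩) := dif_pos h

lemma evalConf_toSphere (ξ : M n → Z) (y : Fin n → ℂ) : evalConf ξ (toSphere y) = pull ξ y := by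
  by_cases h : Function.Injective y
  · rw [evalConf_of_injective ξ (injective_toSphere.2 h), pull, dif_pos (show y ∈ affConf n from h)]
    rfl
  · rw [evalConf, dif_neg (injective_toSphere.not.2 h), pull,
      dif_neg (show y ∉ affConf n from h)]

lemma evalConf_smul (ξ : M n → Z) (g : Moebius) (c : Fin n → Sphere) :
    evalConf ξ (fun i => g • c i) = evalConf ξ c := by
  by_cases h : Function.Injective c
  · rw [evalConf_of_injective ξ h]
    refine (evalConf_of_injective ξ (Conf.smul g ⟨c, h⟩).2).trans ?_
    exact congrArg ξ (M.mk_smul g ⟨c, h⟩)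
  · rw [evalConf, dif_neg, evalConf, dif_neg h]
    exact fun h' => h fun a b e => h' (congrArg (g • ·) e)

lemma evalConf_add (ξ η : M n → Z) (c : Fin n → Sphere) :
    evalConf (ξ + η) c = evalConf ξ c + evalConf η c := by
  by_cases h : Function.Injective c <;> simp [evalConf, h]

lemma evalConf_mem {ξ : M n → Z} {s : Set Z} (h0 : (0 : Z) ∈ s) (h : ∀ u, ξ u ∈ s)
    (c : Fin n → Sphere) : evalConf ξ c ∈ s := by
  unfold evalConf
  split_ifs
  exacts [h _, h0]

lemma pull_affProj (ξ : M n → Z) (x : affConf n) : pull ξ x.1 = ξ (affProj x) := dif_pos x.2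

lemma pull_sub (ξ η : M n → Z) : pull (ξ - η) = pull ξ - pull η := by
  funext x
  by_cases h : x ∈ affConf n <;> simp [pull, h]

variable [NormedSpace ℝ Z]

lemma evalConf_const_smul (a : ℝ) (ξ : M n → Z) (c : Fin n → Sphere) :
    evalConf (a • ξ) c = a • evalConf ξ c := by
  by_cases h : Function.Injective c <;> simp [evalConf, h]

lemma SmoothMap.contDiffOn (ξ : SmoothMap n Z) : ContDiffOn ℝ ∞ (pull ξ.fn) (affConf n) := ξ.2

lemma SmoothMap.contDiffAt (ξ : SmoothMap n Z) {x : Fin n → ℂ} (hx : x ∈ affConf n) :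
    ContDiffAt ℝ ∞ (pull ξ.fn) x :=
  ξ.contDiffOn.contDiffAt (isOpen_affConf.mem_nhds hx)

lemma SmoothMap.continuousAt_evalConf (ξ : SmoothMap n Z) {c : Fin n → Sphere}
    (hc : Function.Injective c) : ContinuousAt (evalConf ξ.fn) c := by
  obtain ⟨g, x, hx⟩ := exists_smul_eq_affToConf ⟨c, hc⟩
  have hgc : (fun i => g • c i) = toSphere x.1 := congrArg Subtype.val hx
  have h1 : ContinuousAt (evalConf ξ.fn) (toSphere x.1) := by
    rw [← (isOpenEmbedding_toSphere n).continuousAt_iff]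
    have := (ξ.contDiffAt x.2).continuousAt
    simpa only [Function.comp_def, evalConf_toSphere] using this
  rw [← hgc] at h1
  have h2 : ContinuousAt (fun (c : Fin n → Sphere) i => g • c i) c :=
    (continuous_pi fun i => (continuous_apply i).const_smul g).continuousAt
  have h3 := ContinuousAt.comp (f := fun (c : Fin n → Sphere) i => g • c i) h1 h2
  simpa only [Function.comp_def, evalConf_smul] using h3

lemma SmoothMap.sub_fn (ξ η : SmoothMap n Z) : (ξ - η).fn = ξ.fn - η.fn := rfl

/-- Convergence in the `C^∞`-topology. -/
lemma SmoothMap.tendsto_iff {α : Type*} {l : Filter α} {u : α → SmoothMap n Z}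
    {ξ : SmoothMap n Z} : Tendsto u l (𝓝 ξ) ↔
      ∀ m : ℕ, ∀ K : Set (Fin n → ℂ), IsCompact K → K ⊆ affConf n → ∀ ε > 0, ∀ᶠ a in l,
        ∀ x ∈ K, ‖iteratedFDeriv ℝ m (pull (u a - ξ).fn) x‖ < ε := by
  rw [nhds_induced, tendsto_comap_iff, tendsto_pi_nhds]
  refine forall_congr' fun m => ?_
  rw [UniformOnFun.tendsto_iff_tendstoUniformlyOn]
  simp only [mem_ofPred_eq, and_imp]
  refine forall_congr' fun K => forall_congr' fun _ => forall_congr' fun hK => ?_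
  rw [Metric.tendstoUniformlyOn_iff]
  refine forall_congr' fun ε => forall_congr' fun _ => eventually_congr (.of_forall fun a => ?_)
  refine forall₂_congr fun x hx => ?_
  have hsub : iteratedFDeriv ℝ m (pull (u a - ξ).fn) x =
      iteratedFDeriv ℝ m (pull (u a).fn) x - iteratedFDeriv ℝ m (pull ξ.fn) x := by
    rw [SmoothMap.sub_fn, pull_sub]
    exact iteratedFDeriv_sub_apply
      (((u a).contDiffAt (hK hx)).of_le (by exact_mod_cast le_top))
      ((ξ.contDiffAt (hK hx)).of_le (by exact_mod_cast le_top))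
  rw [hsub, ← dist_eq_norm, dist_comm]
  rfl

/-- Convergence of maps with support in a relatively compact set implies uniform convergence. -/
lemma CompactlySupported.eventually_norm_sub_lt {U : Set (M n)} (hU : IsCompact (closure U))
    {α : Type*} {l : Filter α} {u : α → CompactlySupported U Z} {ξ : CompactlySupported U Z}
    (h : Tendsto u l (𝓝 ξ)) {ε : ℝ} (hε : 0 < ε) :
    ∀ᶠ a in l, ∀ v, ‖((u a).1 - ξ.1).fn v‖ < ε := by
  obtain ⟨L, hL, hLs, hLU⟩ := exists_isCompact_affConf hU
  have h' := (continuous_subtype_val.tendsto ξ).comp h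
  -- Derivatives of order 0 on a compact lift of the closure of U control the values on U; off U
  -- both maps vanish.
  filter_upwards [SmoothMap.tendsto_iff.1 h' 0 L hL hLs ε hε] with a ha v
  by_cases hv : v ∈ U
  · obtain ⟨x, hx, rfl⟩ := hLU v (subset_closure hv)
    have := ha x.1 hx
    rw [norm_iteratedFDeriv_zero, pull_affProj] at this
    exact this
  · have h1 : (u a).1.fn v = 0 := by
      by_contra hne
      exact hv ((u a).2.2 (subset_tsupport _ hne))
    have h2 : ξ.1.fn v = 0 := by
      by_contra hne
      exact hv (ξ.2.2 (subset_tsupport _ hne))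
    rw [SmoothMap.sub_fn, Pi.sub_apply, h1, h2, sub_zero, norm_zero]
    exact hε

end SmoothMaps

/-! ### Substitution and multiplication by a smooth function -/

section Substitution

variable {E E' Z : Type*} [NormedAddCommGroup E] [NormedSpace ℝ E] [NormedAddCommGroup E']
  [NormedSpace ℝ E'] [NormedAddCommGroup Z] [NormedSpace ℝ Z]

/-- Leibniz rule, with the chain rule for a linear map. The constant is chosen before f and h, which
makes h ↦ B · (h ∘ L) continuous for uniform convergence of derivatives on compact sets. -/
lemma exists_bound_iteratedFDeriv_smul_comp {s : Set E} {t : Set E'} (hs : IsOpen s)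
    (ht : IsOpen t) {B : E → ℝ} (hB : ContDiffOn ℝ ∞ B s) (L : E →L[ℝ] E') (hL : MapsTo L s t)
    {K : Set E} (hK : IsCompact K) (hKs : K ⊆ s) (m : ℕ) :
    ∃ C : ℝ, 0 ≤ C ∧ ∀ (f : E → Z) (h : E' → Z), ContDiffOn ℝ ∞ h t →
      EqOn f (fun x => B x • h (L x)) s → ∀ x ∈ K, ‖iteratedFDeriv ℝ m f x‖ ≤
        C * ∑ j ∈ Finset.range (m + 1), ‖iteratedFDeriv ℝ j h (L x)‖ := by
  have hbd : ∀ i : ℕ, ∃ c : ℝ, 0 ≤ c ∧ ∀ x ∈ K, ‖iteratedFDerivWithin ℝ i B s x‖ ≤ c := by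
    intro i
    have hc : ContinuousOn (iteratedFDerivWithin ℝ i B s) K :=
      (hB.continuousOn_iteratedFDerivWithin (by exact_mod_cast le_top) hs.uniqueDiffOn).mono hKs
    obtain ⟨c, hc⟩ := hK.exists_bound_of_continuousOn hc
    exact ⟨max c 0, le_max_right _ _, fun x hx => (hc x hx).trans (le_max_left _ _)⟩
  choose c hc0 hc using hbd
  refine ⟨∑ i ∈ Finset.range (m + 1), (m.choose i : ℝ) * c i * ‖L‖ ^ (m - i),
    Finset.sum_nonneg fun i _ => mul_nonneg (mul_nonneg (Nat.cast_nonneg _) (hc0 i))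
      (pow_nonneg (norm_nonneg _) _), fun f h hh hf x hx => ?_⟩
  have hxs := hKs hx
  have hpre : IsOpen (L ⁻¹' t) := ht.preimage L.continuous
  have hcomp : ContDiffOn ℝ ∞ (h ∘ L) s :=
    (hh.comp_continuousLinearMap L).mono hL
  have hder : ∀ j : ℕ, ‖iteratedFDerivWithin ℝ j (h ∘ L) s x‖ ≤
      ‖iteratedFDeriv ℝ j h (L x)‖ * ‖L‖ ^ j := by
    intro j
    rw [iteratedFDerivWithin_of_isOpen j hs hxs, ← iteratedFDerivWithin_of_isOpen j hpre (hL hxs),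
      L.iteratedFDerivWithin_comp_right hh ht.uniqueDiffOn hpre.uniqueDiffOn (hL hxs)
        (by exact_mod_cast le_top), iteratedFDerivWithin_of_isOpen j ht (hL hxs)]
    refine (ContinuousMultilinearMap.norm_compContinuousLinearMap_le _ _).trans ?_
    simp
  rw [← iteratedFDerivWithin_of_isOpen m hs hxs, iteratedFDerivWithin_congr hf hxs,
    Finset.sum_mul]
  refine (norm_iteratedFDerivWithin_smul_le hB hcomp hs.uniqueDiffOn hxs
    (by exact_mod_cast le_top)).trans (Finset.sum_le_sum fun i hi => ?_)
  have hle : ‖iteratedFDeriv ℝ (m - i) h (L x)‖ ≤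
      ∑ j ∈ Finset.range (m + 1), ‖iteratedFDeriv ℝ j h (L x)‖ :=
    Finset.single_le_sum (f := fun j => ‖iteratedFDeriv ℝ j h (L x)‖)
      (fun j _ => norm_nonneg _) (Finset.mem_range.2 (by omega))
  calc (m.choose i : ℝ) * ‖iteratedFDerivWithin ℝ i B s x‖ *
        ‖iteratedFDerivWithin ℝ (m - i) (h ∘ L) s x‖
      ≤ (m.choose i : ℝ) * c i * (‖iteratedFDeriv ℝ (m - i) h (L x)‖ * ‖L‖ ^ (m - i)) := by
        have := hc i x hx
        have := hder (m - i)
        have := hc0 i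
        gcongr
    _ = (m.choose i : ℝ) * c i * ‖L‖ ^ (m - i) * ‖iteratedFDeriv ℝ (m - i) h (L x)‖ := by ring
    _ ≤ _ := by
        have := hc0 i
        gcongr

/-- The linear map permuting, repeating or omitting coordinates. -/
def substitution {m n : ℕ} (σ : Fin n → Fin m) : (Fin m → ℂ) →L[ℝ] (Fin n → ℂ) :=
  ContinuousLinearMap.pi fun i => ContinuousLinearMap.proj (σ i)

variable {m n : ℕ} {B : (Fin m → ℂ) → ℝ} {σ : Fin n → Fin m}

lemma mapsTo_substitution (hσ : Function.Injective σ) :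
    MapsTo (substitution σ) (affConf m) (affConf n) := fun y hy =>
  show Function.Injective (y ∘ σ) from Function.Injective.comp hy hσ

lemma contDiffOn_pull_of_eqOn (hB : ContDiffOn ℝ ∞ B (affConf m)) (hσ : Function.Injective σ)
    (ξ : SmoothMap n Z) {η : M m → Z}
    (h : EqOn (pull η) (fun y => B y • pull ξ.fn (substitution σ y)) (affConf m)) :
    ContDiffOn ℝ ∞ (pull η) (affConf m) :=
  (hB.smul ((ξ.contDiffOn.comp_continuousLinearMap (substitution σ)).mono
    (mapsTo_substitution hσ))).congr h

/-- The Leibniz estimate is applied to the differences; injectivity of σ keeps the substituted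
points distinct. -/
lemma tendsto_of_eqOn (hB : ContDiffOn ℝ ∞ B (affConf m)) (hσ : Function.Injective σ)
    {α : Type*} {l : Filter α} {u : α → SmoothMap n Z} {ξ : SmoothMap n Z} (hu : Tendsto u l (𝓝 ξ))
    {v : α → SmoothMap m Z} {η : SmoothMap m Z}
    (h : ∀ a, EqOn (pull (v a - η).fn)
      (fun y => B y • pull (u a - ξ).fn (substitution σ y)) (affConf m)) :
    Tendsto v l (𝓝 η) := by
  rw [SmoothMap.tendsto_iff] at hu ⊢
  intro r K hK hKs ε hε
  obtain ⟨C, hC0, hC⟩ := exists_bound_iteratedFDeriv_smul_comp (Z := Z) isOpen_affConf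
    isOpen_affConf hB (substitution σ) (mapsTo_substitution hσ) hK hKs r
  have hK' : IsCompact (substitution σ '' K) := hK.image (substitution σ).continuous
  have hKs' : substitution σ '' K ⊆ affConf n :=
    ((mapsTo_substitution hσ).mono_left hKs).image_subset
  -- The sum has r + 1 terms; C + 1 replaces C because C may be 0.
  have hδ : 0 < ε / ((C + 1) * (r + 1)) := by positivity
  have hev : ∀ᶠ a in l, ∀ j ∈ Finset.range (r + 1), ∀ x ∈ substitution σ '' K,
      ‖iteratedFDeriv ℝ j (pull (u a - ξ).fn) x‖ < ε / ((C + 1) * (r + 1)) :=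
    (Finset.eventually_all _).2 fun j _ => hu j _ hK' hKs' _ hδ
  filter_upwards [hev] with a ha x hx
  refine (hC _ _ (u a - ξ).contDiffOn (h a) x hx).trans_lt ?_
  have hsum : ∑ j ∈ Finset.range (r + 1),
      ‖iteratedFDeriv ℝ j (pull (u a - ξ).fn) (substitution σ x)‖ ≤
        (r + 1) * (ε / ((C + 1) * (r + 1))) := by
    refine (Finset.sum_le_card_nsmul _ _ _ fun j hj =>
      (ha j hj _ (mem_image_of_mem _ hx)).le).trans_eq ?_
    rw [Finset.card_range, nsmul_eq_mul]
    push_cast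
    rfl
  have hr : (r : ℝ) + 1 ≠ 0 := by positivity
  have hC1 : C + 1 ≠ 0 := by positivity
  calc _ ≤ C * ((r + 1) * (ε / ((C + 1) * (r + 1)))) := mul_le_mul_of_nonneg_left hsum hC0
    _ = C / (C + 1) * ε := by field_simp
    _ < 1 * ε := by
      refine mul_lt_mul_of_pos_right ?_ hε
      rw [div_lt_one (by positivity)]
      exact lt_add_one C
    _ = ε := one_mul ε

end Substitution

/-! ### Cutoff functions -/

/-- A smooth function which vanishes for `t ≤ ε` and equals `1` for `2 * ε ≤ t`. -/
def cutUp (ε t : ℝ) : ℝ := Real.smoothTransition ((t - ε) / ε)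

/-- A smooth function which equals `1` for `t ≤ 0` and vanishes for `ε / 2 ≤ t`. -/
def cutDown (ε t : ℝ) : ℝ := Real.smoothTransition (1 - 2 * t / ε)

section Cutoff

variable {k : ℕ} {ε : ℝ} {r : Setoid (Fin (k + 1))}

open Classical in
/-- The factor of the cutoff function which belongs to a pair of marked points. -/
def cutFactor (ε : ℝ) (r : Setoid (Fin (k + 1))) (i j : Fin (k + 1)) (t : ℝ) : ℝ :=
  -- An inequivalent pair involving the label 0 needs the factor 1: its gap is 0 by the division
  -- convention, so `cutUp` would annihilate the whole product.
  if r i j then cutDown ε t else if i = 0 ∨ j = 0 then 1 else cutUp ε t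

/-- A Möbius invariant cutoff function: it is supported in the set of all configurations for which
the gaps of equivalent points are small and those of inequivalent points are not. -/
def cutoff (ε : ℝ) (r : Setoid (Fin (k + 1))) (c : Fin (k + 1) → Sphere) : ℝ :=
  ∏ i, ∏ j, cutFactor ε r i j (gap c i j)

lemma cutoff_smul (g : Moebius) (c : Fin (k + 1) → Sphere) :
    cutoff ε r (fun i => g • c i) = cutoff ε r c := by
  simp only [cutoff, gap_smul]

lemma contDiff_cutFactor (i j : Fin (k + 1)) : ContDiff ℝ ∞ (cutFactor ε r i j) := by
  unfold cutFactor
  split_ifs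
  · exact Real.smoothTransition.contDiff.comp
      (contDiff_const.sub ((contDiff_const.mul contDiff_id).div_const ε))
  · exact contDiff_const
  · exact Real.smoothTransition.contDiff.comp ((contDiff_id.sub contDiff_const).div_const ε)

lemma cutFactor_mem_Icc (i j : Fin (k + 1)) (t : ℝ) : cutFactor ε r i j t ∈ Icc (0 : ℝ) 1 := by
  unfold cutFactor
  split_ifs
  · exact ⟨Real.smoothTransition.nonneg _, Real.smoothTransition.le_one _⟩
  · exact ⟨zero_le_one, le_rfl⟩
  · exact ⟨Real.smoothTransition.nonneg _, Real.smoothTransition.le_one _⟩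

lemma cutoff_nonneg (c : Fin (k + 1) → Sphere) : 0 ≤ cutoff ε r c :=
  Finset.prod_nonneg fun i _ => Finset.prod_nonneg fun j _ => (cutFactor_mem_Icc i j _).1

lemma cutoff_le_one (c : Fin (k + 1) → Sphere) : cutoff ε r c ≤ 1 :=
  Finset.prod_le_one (fun i _ => Finset.prod_nonneg fun j _ => (cutFactor_mem_Icc i j _).1)
    fun i _ => Finset.prod_le_one (fun j _ => (cutFactor_mem_Icc i j _).1)
      fun j _ => (cutFactor_mem_Icc i j _).2

lemma cutoff_eq_zero {c : Fin (k + 1) → Sphere} {i j : Fin (k + 1)}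
    (h : cutFactor ε r i j (gap c i j) = 0) : cutoff ε r c = 0 :=
  Finset.prod_eq_zero (Finset.mem_univ i) (Finset.prod_eq_zero (Finset.mem_univ j) h)

lemma cutoff_eq_zero_of_gap_le (hε : 0 < ε) {c : Fin (k + 1) → Sphere} {i j : Fin (k + 1)}
    (hr : ¬ r i j) (hi : i ≠ 0) (hj : j ≠ 0) (h : gap c i j ≤ ε) : cutoff ε r c = 0 := by
  refine cutoff_eq_zero (i := i) (j := j) ?_
  rw [cutFactor, if_neg hr, if_neg (by tauto)]
  exact Real.smoothTransition.zero_of_nonpos (div_nonpos_of_nonpos_of_nonneg (by linarith) hε.le)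

lemma cutoff_eq_zero_of_le_gap (hε : 0 < ε) {c : Fin (k + 1) → Sphere} {i j : Fin (k + 1)}
    (hr : r i j) (h : ε / 2 ≤ gap c i j) : cutoff ε r c = 0 := by
  refine cutoff_eq_zero (i := i) (j := j) ?_
  rw [cutFactor, if_pos hr]
  refine Real.smoothTransition.zero_of_nonpos ?_
  rw [sub_nonpos, one_le_div hε]
  linarith

lemma cutoff_eq_one (hε : 0 < ε) {c : Fin (k + 1) → Sphere} (h0 : ∀ i j, r i j → c i = c j)
    (h : ∀ i j, i ≠ 0 → j ≠ 0 → ¬ r i j → 2 * ε ≤ gap c i j) : cutoff ε r c = 1 := by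
  refine Finset.prod_eq_one fun i _ => Finset.prod_eq_one fun j _ => ?_
  unfold cutFactor
  split_ifs with hr hij
  · rw [gap_eq_zero (h0 i j hr)]
    exact Real.smoothTransition.one_of_one_le (by simp)
  · rfl
  · rw [not_or] at hij
    refine Real.smoothTransition.one_of_one_le ?_
    rw [one_le_div hε]
    linarith [h i j hij.1 hij.2 hr]

lemma contDiffAt_cutoff {y : Fin (k + 1) → ℂ} (hy : Admissible (toSphere y)) :
    ContDiffAt ℝ ∞ (fun y => cutoff ε r (toSphere y)) y := by
  unfold cutoff
  refine contDiffAt_prod fun i _ => contDiffAt_prod fun j _ => ?_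
  exact (contDiff_cutFactor i j).contDiffAt.comp y (contDiffAt_gap hy i j)

lemma continuousAt_cutoff {c : Fin (k + 1) → Sphere} (hc : Admissible c) :
    ContinuousAt (cutoff ε r) c := by
  unfold cutoff
  refine tendsto_finsetProd _ fun i _ => tendsto_finsetProd _ fun j _ => ?_
  exact (contDiff_cutFactor i j).continuous.continuousAt.comp (continuousAt_gap hc i j)

end Cutoff

/-! ### Stable decompositions -/

namespace StableDecomp

variable {k : ℕ}

instance : Finite (StableDecomp k) := by
  refine Finite.of_injective
    (fun I : StableDecomp k => {p : Fin (k + 1) × Fin (k + 1) | I.rel p.1 p.2}) fun I J h => ?_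
  ext i j
  exact Set.ext_iff.1 h (i, j)

/-- Every stable decomposition has {0} as a class, so two of them cannot disagree about a pair
involving 0. -/
lemma ne_zero_left (I J : StableDecomp k) {i j : Fin (k + 1)} (h : I.rel i j) (h' : ¬ J.rel i j) :
    i ≠ 0 := by
  rintro rfl
  have := I.zero_class j (I.rel.symm h)
  subst this
  exact h' (J.rel.refl _)

lemma ne_zero_right (I J : StableDecomp k) {i j : Fin (k + 1)} (h : I.rel i j)
    (h' : ¬ J.rel i j) : j ≠ 0 :=
  ne_zero_left I J (I.rel.symm h) fun e => h' (J.rel.symm e)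

/-- If J refined I, the minima of the classes of I would also be minima of classes of J. -/
lemma exists_rel_not_rel {I J : StableDecomp k} (h : J.size < I.size) :
    ∃ i j, J.rel i j ∧ ¬ I.rel i j := by
  by_contra! hno
  refine absurd h (not_lt.2 (Finset.card_le_card fun i hi => ?_))
  exact mem_minima.2 fun j hj => mem_minima.1 hi j (hno i j hj)

lemma exists_rel_not_rel_of_ne {I J : StableDecomp k} (h : I ≠ J) :
    (∃ i j, I.rel i j ∧ ¬ J.rel i j) ∨ ∃ i j, J.rel i j ∧ ¬ I.rel i j := by
  by_contra! hno
  refine h (StableDecomp.ext (Setoid.ext fun i j => ⟨hno.1 i j, hno.2 i j⟩))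

variable (I : StableDecomp k)

/-- The configuration with multiple points which places every class of `I` at a given point. -/
def spreadOut {X : Type*} (c : Fin I.size → X) : Fin (k + 1) → X := fun i => c (I.cls i)

lemma spreadOut_rep {X : Type*} (c : Fin I.size → X) (a : Fin I.size) :
    I.spreadOut c (I.rep a) = c a := by rw [spreadOut, cls_rep]

lemma root_starCurve (x : Conf I.size) : (I.starCurve x).root = I.spreadOut x.1 := by
  funext i
  rw [StableCurve.root, starCurve_vert_zero, starCurve_seen, spreadOut]

/-- The configuration is the root configuration of a star-shaped curve. -/
lemma admissible_spreadOut (x : Conf I.size) : Admissible (I.spreadOut x.1) := by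
  rw [← root_starCurve]
  exact (I.starCurve x).admissible_root

lemma root_eq_spreadOut {z : StableCurve (k + 1)} (hz : z.rootRel = I.rel) :
    z.root = I.spreadOut (rootConf I z hz).1 := by
  funext i
  have h := I.rep_cls i
  rw [← hz] at h
  exact h.symm

lemma rep_ne_zero_of_eq {c : Fin (k + 1) → Sphere} (hc : Admissible c) {a b : Fin I.size}
    (h : c (I.rep a) = c (I.rep b)) (hab : a ≠ b) : I.rep a ≠ 0 := by
  intro h0
  refine hc.1 (I.rep b) (fun hb => hab (I.rep.injective (h0.trans hb.symm))) ?_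
  rw [← h, h0]

end StableDecomp

/-! ### The extension operators -/

section Extension

variable {k : ℕ} {Z : Type*} [NormedAddCommGroup Z] [NormedSpace ℝ Z] {ε : ℝ}

/-- The extension of a map on the moduli space to a Möbius invariant map on configurations
with multiple points. -/
def extension (ε : ℝ) (I : StableDecomp k) (ξ : M I.size → Z) (c : Fin (k + 1) → Sphere) : Z :=
  cutoff ε I.rel c • evalConf ξ fun a => c (I.rep a)

lemma extension_smul (I : StableDecomp k) (ξ : M I.size → Z) (g : Moebius)
    (c : Fin (k + 1) → Sphere) : extension ε I ξ (fun i => g • c i) = extension ε I ξ c := by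
  rw [extension, cutoff_smul, extension, evalConf_smul ξ g fun a => c (I.rep a)]

lemma extension_add (I : StableDecomp k) (ξ η : M I.size → Z) (c : Fin (k + 1) → Sphere) :
    extension ε I (ξ + η) c = extension ε I ξ c + extension ε I η c := by
  simp only [extension, evalConf_add, smul_add]

lemma extension_const_smul (I : StableDecomp k) (a : ℝ) (ξ : M I.size → Z)
    (c : Fin (k + 1) → Sphere) : extension ε I (a • ξ) c = a • extension ε I ξ c := by
  simp only [extension, evalConf_const_smul, smul_comm a]

lemma extension_sub (I : StableDecomp k) (ξ η : M I.size → Z) (c : Fin (k + 1) → Sphere) :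
    extension ε I (ξ - η) c = extension ε I ξ c - extension ε I η c := by
  rw [eq_sub_iff_add_eq, ← extension_add, sub_add_cancel]

lemma extension_eq_zero {I : StableDecomp k} {ξ : M I.size → Z} {c : Fin (k + 1) → Sphere}
    (h : cutoff ε I.rel c = 0) : extension ε I ξ c = 0 := by
  rw [extension, h, zero_smul]

/-- Two coinciding representatives have gap 0, hence gap below ε nearby, although they are
inequivalent. This hides the arbitrary value of `evalConf` at configurations with repeated points.
-/
lemma cutoff_eventually_eq_zero (hε : 0 < ε) (I : StableDecomp k) {c : Fin (k + 1) → Sphere}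
    (hc : Admissible c) (h : ¬ Function.Injective fun a => c (I.rep a)) :
    ∀ᶠ d in 𝓝 c, cutoff ε I.rel d = 0 := by
  simp only [Function.Injective, not_forall] at h
  obtain ⟨a, b, hab, hne⟩ := h
  have h1 := continuousAt_gap hc (I.rep a) (I.rep b)
  have h2 : gap c (I.rep a) (I.rep b) < ε := by rwa [gap_eq_zero hab]
  filter_upwards [h1.eventually (gt_mem_nhds h2)] with d hd
  exact cutoff_eq_zero_of_gap_le hε (fun e => hne (I.rep_injective_class e))
    (I.rep_ne_zero_of_eq hc hab hne) (I.rep_ne_zero_of_eq hc hab.symm (Ne.symm hne)) hd.le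

lemma continuousAt_extension (hε : 0 < ε) (I : StableDecomp k) (ξ : SmoothMap I.size Z)
    {c : Fin (k + 1) → Sphere} (hc : Admissible c) : ContinuousAt (extension ε I ξ.fn) c := by
  by_cases h : Function.Injective fun a => c (I.rep a)
  · refine (continuousAt_cutoff hc).smul ?_
    exact ContinuousAt.comp (f := fun (c : Fin (k + 1) → Sphere) a => c (I.rep a))
      (ξ.continuousAt_evalConf h)
      (continuous_pi fun a => continuous_apply (I.rep a)).continuousAt
  · have h0 : (0 : (Fin (k + 1) → Sphere) → Z) =ᶠ[𝓝 c] extension ε I ξ.fn := by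
      filter_upwards [cutoff_eventually_eq_zero hε I hc h] with d hd
      exact (extension_eq_zero hd).symm
    exact continuousAt_const.congr h0

/-- The cutoff is a factor in [0,1]. Besides star-shaped targets, this is applied to balls for the
C^0 estimate. -/
lemma extension_mem {I : StableDecomp k} {ξ : M I.size → Z} {s : Set Z} (h0 : (0 : Z) ∈ s)
    (hs : StarConvex ℝ 0 s) (h : ∀ u, ξ u ∈ s) (c : Fin (k + 1) → Sphere) :
    extension ε I ξ c ∈ s :=
  hs.smul_mem (evalConf_mem h0 h _) (cutoff_nonneg c) (cutoff_le_one c)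

/-! ### Extensions on the Deligne–Mumford space and their supports -/

/-- The gap of two points on the component carrying the marked point `0`. -/
def MBar.gap (i j : Fin (k + 1)) : MBar (k + 1) → ℝ :=
  MBar.ofRoot (fun c => CoherentMaps.gap c i j) fun g c => gap_smul g c i j

lemma MBar.continuous_gap (i j : Fin (k + 1)) :
    Continuous (MBar.gap i j : MBar (k + 1) → ℝ) :=
  MBar.continuous_ofRoot _ fun _ hc => continuousAt_gap hc i j

/-- The extension of a map on the moduli space to the Deligne-Mumford space. -/
def extMap (hε : 0 < ε) (I : StableDecomp k) (ξ : SmoothMap I.size Z) : C(MBar (k + 1), Z) where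
  toFun := MBar.ofRoot (extension ε I ξ.fn) fun g c => extension_smul I ξ.fn g c
  continuous_toFun := MBar.continuous_ofRoot _ fun _ hc => continuousAt_extension hε I ξ hc

lemma extMap_mk (hε : 0 < ε) (I : StableDecomp k) (ξ : SmoothMap I.size Z)
    (z : StableCurve (k + 1)) : extMap hε I ξ (MBar.mk z) = extension ε I ξ.fn z.root := rfl

lemma extMap_eq_zero_of_gap_le (hε : 0 < ε) (I : StableDecomp k) (ξ : SmoothMap I.size Z)
    {i j : Fin (k + 1)} (hr : ¬ I.rel i j) (hi : i ≠ 0) (hj : j ≠ 0) {x : MBar (k + 1)}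
    (hx : MBar.gap i j x ≤ ε) : extMap hε I ξ x = 0 := by
  obtain ⟨z, rfl⟩ : ∃ z, MBar.mk z = x := Quotient.exists_rep x
  exact extension_eq_zero (cutoff_eq_zero_of_gap_le hε hr hi hj hx)

lemma extMap_eq_zero_of_le_gap (hε : 0 < ε) (I : StableDecomp k) (ξ : SmoothMap I.size Z)
    {i j : Fin (k + 1)} (hr : I.rel i j) {x : MBar (k + 1)}
    (hx : ε / 2 ≤ MBar.gap i j x) : extMap hε I ξ x = 0 := by
  obtain ⟨z, rfl⟩ : ∃ z, MBar.mk z = x := Quotient.exists_rep x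
  exact extension_eq_zero (cutoff_eq_zero_of_le_gap hε hr hx)

/-- The pair on which I and J disagree separates the supports by closed conditions on its gap; the
margin between ε/2 and ε keeps even the closures apart. -/
lemma disjoint_tsupport_extMap_of_rel (hε : 0 < ε) {I J : StableDecomp k} {i j : Fin (k + 1)}
    (hI : I.rel i j) (hJ : ¬ J.rel i j) (ξ : SmoothMap I.size Z) (η : SmoothMap J.size Z) :
    Disjoint (tsupport (extMap hε I ξ)) (tsupport (extMap hε J η)) := by
  have h1 : tsupport (extMap hε I ξ) ⊆ {x | MBar.gap i j x ≤ ε / 2} := by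
    refine closure_minimal (fun x hx => ?_)
      (isClosed_le (MBar.continuous_gap i j) continuous_const)
    by_contra hlt
    exact hx (extMap_eq_zero_of_le_gap hε I ξ hI (not_le.1 hlt).le)
  have h2 : tsupport (extMap hε J η) ⊆ {x | ε ≤ MBar.gap i j x} := by
    refine closure_minimal (fun x hx => ?_)
      (isClosed_le continuous_const (MBar.continuous_gap i j))
    by_contra hlt
    exact hx (extMap_eq_zero_of_gap_le hε J η hJ (I.ne_zero_left J hI hJ)
      (I.ne_zero_right J hI hJ) (not_le.1 hlt).le)
  refine (Set.disjoint_left.2 fun x hx hx' => ?_).mono h1 h2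
  have := le_trans (mem_ofPred.1 hx') (mem_ofPred.1 hx)
  linarith

lemma disjoint_tsupport_extMap (hε : 0 < ε) {I J : StableDecomp k} (h : I ≠ J)
    (ξ : SmoothMap I.size Z) (η : SmoothMap J.size Z) :
    Disjoint (tsupport (extMap hε I ξ)) (tsupport (extMap hε J η)) := by
  rcases StableDecomp.exists_rel_not_rel_of_ne h with ⟨i, j, hI, hJ⟩ | ⟨i, j, hJ, hI⟩
  · exact disjoint_tsupport_extMap_of_rel hε hI hJ ξ η
  · exact (disjoint_tsupport_extMap_of_rel hε hJ hI η ξ).symm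

lemma extMap_eventually_eq_zero (hε : 0 < ε) {I J : StableDecomp k} (h : J.size < I.size)
    (ξ : SmoothMap I.size Z) : ∀ᶠ x in 𝓝ˢ (stratum J), extMap hε I ξ x = 0 := by
  obtain ⟨i, j, hJ, hI⟩ := StableDecomp.exists_rel_not_rel h
  have hopen : IsOpen {x : MBar (k + 1) | MBar.gap i j x < ε} :=
    isOpen_lt (MBar.continuous_gap i j) continuous_const
  have hsub : stratum J ⊆ {x : MBar (k + 1) | MBar.gap i j x < ε} := by
    intro x hx
    obtain ⟨z, rfl⟩ : ∃ z, MBar.mk z = x := Quotient.exists_rep x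
    have hx' : z.rootRel = J.rel := hx
    rw [← hx'] at hJ
    have hz : MBar.gap i j (MBar.mk z) = 0 := gap_eq_zero (c := z.root) hJ
    rw [mem_ofPred_eq, hz]
    exact hε
  filter_upwards [hopen.mem_nhdsSet.2 hsub] with x hx
  exact extMap_eq_zero_of_gap_le hε I ξ hI (J.ne_zero_left I hJ hI) (J.ne_zero_right I hJ hI)
    (le_of_lt (mem_ofPred.1 hx))

/-! ### Restriction of the extensions to the strata -/

variable (I J : StableDecomp k)

/-- The map which the extension induces on the moduli space belonging to the stratum of `J`. -/
def stratumMap (ε : ℝ) (ξ : M I.size → Z) : M J.size → Z :=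
  Quotient.lift (fun x : Conf J.size => extension ε I ξ (J.spreadOut x.1)) (by
    rintro x y ⟨g, hg⟩
    have h : J.spreadOut y.1 = fun i => g • J.spreadOut x.1 i := funext fun i => hg _
    change extension ε I ξ (J.spreadOut x.1) = extension ε I ξ (J.spreadOut y.1)
    rw [h, extension_smul])

lemma stratumMap_mk (ξ : M I.size → Z) (x : Conf J.size) :
    stratumMap I J ε ξ (M.mk x) = extension ε I ξ (J.spreadOut x.1) := rfl

lemma stratumMap_sub (ξ η : M I.size → Z) :
    stratumMap I J ε (ξ - η) = stratumMap I J ε ξ - stratumMap I J ε η := by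
  funext u
  obtain ⟨x, rfl⟩ : ∃ x, M.mk x = u := Quotient.exists_rep u
  exact extension_sub I ξ η _

/-- The cutoff function on the stratum of `J`, in affine coordinates. -/
def stratumCutoff (ε : ℝ) (y : Fin J.size → ℂ) : ℝ :=
  cutoff ε I.rel (toSphere (J.spreadOut y))

lemma contDiffOn_stratumCutoff : ContDiffOn ℝ ∞ (stratumCutoff I J ε) (affConf J.size) := by
  intro y hy
  refine ContDiffAt.contDiffWithinAt ?_
  have h := contDiffAt_cutoff (ε := ε) (r := I.rel) (y := J.spreadOut y)
    (J.admissible_spreadOut (affToConf ⟨y, hy⟩))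
  exact h.comp y (substitution J.cls).contDiff.contDiffAt

/-- On the stratum of J the i-th point is the point of its J-class, so restricting to the
representatives of I only substitutes coordinates. -/
lemma pull_stratumMap (ξ : M I.size → Z) : EqOn (pull (stratumMap I J ε ξ))
    (fun y => stratumCutoff I J ε y • pull ξ (substitution (fun a => J.cls (I.rep a)) y))
    (affConf J.size) := by
  intro y hy
  change pull _ y = _ • pull _ _
  rw [pull_affProj _ ⟨y, hy⟩, affProj_eq, stratumMap_mk, ← evalConf_toSphere]
  rfl

/-- Two representatives of I in one class of J coincide throughout the stratum of J, where the
cutoff therefore vanishes. -/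
lemma stratumMap_eq_zero (hε : 0 < ε) (h : ¬ Function.Injective fun a => J.cls (I.rep a))
    (ξ : M I.size → Z) : stratumMap I J ε ξ = 0 := by
  funext u
  obtain ⟨x, rfl⟩ : ∃ x, M.mk x = u := Quotient.exists_rep u
  have hx : ¬ Function.Injective fun a => J.spreadOut x.1 (I.rep a) := fun h' =>
    h fun a b e => h' (congrArg x.1 e)
  exact extension_eq_zero
    (cutoff_eventually_eq_zero hε I (J.admissible_spreadOut x) hx).self_of_nhds

/-- The map which the extension induces on the moduli space belonging to the stratum of `J`, as a
smooth map. -/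
def stratumSmooth (hε : 0 < ε) (ξ : SmoothMap I.size Z) : SmoothMap J.size Z :=
  ⟨stratumMap I J ε ξ.fn, by
    by_cases h : Function.Injective fun a => J.cls (I.rep a)
    · exact contDiffOn_pull_of_eqOn (contDiffOn_stratumCutoff I J) h ξ (pull_stratumMap I J ξ.fn)
    · rw [stratumMap_eq_zero I J hε h]
      exact (smoothSubmodule J.size Z).zero_mem⟩

lemma stratumSmooth_fn (hε : 0 < ε) (ξ : SmoothMap I.size Z) :
    (stratumSmooth I J hε ξ).fn = stratumMap I J ε ξ.fn := rfl

lemma continuous_stratumSmooth (hε : 0 < ε) :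
    Continuous (stratumSmooth I J hε : SmoothMap I.size Z → SmoothMap J.size Z) := by
  by_cases h : Function.Injective fun a => J.cls (I.rep a)
  · refine continuous_iff_continuousAt.2 fun ξ => ?_
    refine tendsto_of_eqOn (contDiffOn_stratumCutoff I J (ε := ε)) h tendsto_id fun η => ?_
    rw [SmoothMap.sub_fn, stratumSmooth_fn, stratumSmooth_fn, ← stratumMap_sub]
    exact pull_stratumMap I J _
  · have h0 : (stratumSmooth I J hε : SmoothMap I.size Z → SmoothMap J.size Z) = fun _ => 0 :=
      funext fun ξ => Subtype.ext (stratumMap_eq_zero I J hε h ξ.fn)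
    rw [h0]
    exact continuous_const

lemma extMap_eq_stratumSmooth (hε : 0 < ε) (ξ : SmoothMap I.size Z) (x : stratum J) :
    extMap hε I ξ x = (stratumSmooth I J hε ξ).fn (proj J x) := by
  obtain ⟨x, hx⟩ := x
  obtain ⟨z, rfl⟩ : ∃ z, MBar.mk z = x := Quotient.exists_rep x
  have hz : z.rootRel = J.rel := hx
  rw [proj_mk J z hz, stratumSmooth_fn, stratumMap_mk, extMap_mk, J.root_eq_spreadOut hz]

/-! ### The extension operators and their properties -/

variable {I J}

/-- The extension operator with values in the coherent maps. -/
def extCoh (hε : 0 < ε) (I : LargeDecomp k) : SmoothMap I.1.size Z →ₗ[ℝ] Coh k Z where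
  toFun ξ := ⟨extMap hε I.1 ξ,
    fun J hJ => extMap_eventually_eq_zero hε (by rw [hJ]; exact I.2) ξ,
    fun J _ => ⟨stratumSmooth I.1 J hε ξ, extMap_eq_stratumSmooth I.1 J hε ξ⟩⟩
  map_add' ξ η := by
    refine Subtype.ext (ContinuousMap.ext fun x => ?_)
    obtain ⟨z, rfl⟩ : ∃ z, MBar.mk z = x := Quotient.exists_rep x
    exact extension_add I.1 ξ.fn η.fn z.root
  map_smul' a ξ := by
    refine Subtype.ext (ContinuousMap.ext fun x => ?_)
    obtain ⟨z, rfl⟩ : ∃ z, MBar.mk z = x := Quotient.exists_rep x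
    exact extension_const_smul I.1 a ξ.fn z.root

/-- Uniqueness identifies the component picked by choice with the explicit one, whose continuity is
known. -/
lemma extCoh_comp (hε : 0 < ε) (I J : LargeDecomp k) (ξ : SmoothMap I.1.size Z) :
    (extCoh hε I ξ).comp J = stratumSmooth I.1 J.1 hε ξ :=
  Coh.comp_unique _ _ _ (extMap_eq_stratumSmooth I.1 J.1 hε ξ)

lemma dist_extMap_lt (hε : 0 < ε) (I : StableDecomp k) {ξ η : SmoothMap I.size Z} {δ : ℝ}
    (hδ : 0 < δ) (h : ∀ v, ‖(ξ - η).fn v‖ < δ) (x : MBar (k + 1)) :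
    dist (extMap hε I ξ x) (extMap hε I η x) < δ := by
  obtain ⟨z, rfl⟩ : ∃ z, MBar.mk z = x := Quotient.exists_rep x
  rw [extMap_mk, extMap_mk, dist_eq_norm, ← extension_sub, ← mem_ball_zero_iff]
  exact extension_mem (Metric.mem_ball_self hδ)
    ((convex_ball (0 : Z) δ).starConvex (Metric.mem_ball_self hδ))
    (fun v => mem_ball_zero_iff.2 (h v)) _

/-- The components on the strata are continuous on all smooth maps; only the C^0 part needs supports
in a relatively compact set. -/
lemma continuous_extCoh (hε : 0 < ε) (I : LargeDecomp k) {U : Set (M I.1.size)}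
    (hU : IsCompact (closure U)) :
    Continuous fun ξ : CompactlySupported U Z => extCoh hε I ξ.1 := by
  refine continuous_induced_rng.2 (Continuous.prodMk ?_ (continuous_pi fun J => ?_))
  · refine continuous_iff_continuousAt.2 fun ξ => ?_
    refine UniformFun.tendsto_iff_tendstoUniformly.2 (Metric.tendstoUniformly_iff.2 fun δ hδ => ?_)
    filter_upwards [CompactlySupported.eventually_norm_sub_lt hU tendsto_id hδ (ξ := ξ)]
      with η hη x
    rw [dist_comm]
    exact dist_extMap_lt hε I.1 hδ hη x
  · simp only [extCoh_comp]
    exact (continuous_stratumSmooth I.1 J.1 hε).comp continuous_subtype_val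

/-- The radial homotopy p ↦ (1 - t) p stays in the star-shaped set and ends at 0. -/
lemma mapsInto_of_starConvex {F : Coh k Z} {s : Set Z} (h0 : (0 : Z) ∈ s) (hs : StarConvex ℝ 0 s)
    (hF : ∀ x, F.fn x ∈ s) : F.MapsInto s := by
  refine ⟨range_subset_iff.2 hF, ⟨0, h0⟩, ⟨?_⟩⟩
  refine
    { toFun := fun p => ⟨(1 - (p.1 : ℝ)) • p.2.1, hs.smul_mem (range_subset_iff.2 hF p.2.2)
        (sub_nonneg.2 p.1.2.2) (sub_le_self _ p.1.2.1)⟩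
      continuous_toFun := by fun_prop
      map_zero_left := fun x => Subtype.ext ?_
      map_one_left := fun x => Subtype.ext ?_ }
  · simp
  · simp

/-- A relatively compact set in the moduli space stays away from the boundary, uniformly for all
decompositions. -/
lemma exists_gap_lower_bound {U : ∀ I : LargeDecomp k, Set (M I.1.size)}
    (hU : ∀ I, IsCompact (closure (U I))) :
    ∃ ε : ℝ, 0 < ε ∧ ∀ (I : LargeDecomp k) (x : Conf I.1.size), M.mk x ∈ U I →
      ∀ i j, i ≠ 0 → j ≠ 0 → ¬ I.1.rel i j → 2 * ε ≤ gap (I.1.spreadOut x.1) i j := by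
  -- Stated for all small ε > 0, the bound passes to the finitely many I, i and j simultaneously.
  have key : ∀ᶠ ε : ℝ in 𝓝[>] 0, ∀ (I : LargeDecomp k) (i j : Fin (k + 1)),
      ∀ x : Conf I.1.size, M.mk x ∈ U I →
      i ≠ 0 → j ≠ 0 → ¬ I.1.rel i j → 2 * ε ≤ gap (I.1.spreadOut x.1) i j := by
    refine eventually_all.2 fun I => eventually_all.2 fun i => eventually_all.2 fun j => ?_
    by_cases hij : i ≠ 0 ∧ j ≠ 0 ∧ ¬ I.1.rel i j
    · let G : M I.1.size → ℝ :=
        Quotient.lift (fun x : Conf I.1.size => gap (I.1.spreadOut x.1) i j) (by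
          rintro x y ⟨g, hg⟩
          have h : I.1.spreadOut y.1 = fun i => g • I.1.spreadOut x.1 i := funext fun i => hg _
          change gap (I.1.spreadOut x.1) i j = gap (I.1.spreadOut y.1) i j
          rw [h, gap_smul])
      have hG : Continuous G := by
        refine Continuous.quotient_lift (continuous_iff_continuousAt.2 fun x => ?_) _
        have h2 : Continuous fun x : Conf I.1.size => I.1.spreadOut x.1 :=
          continuous_pi fun i => (continuous_apply (I.1.cls i)).comp continuous_subtype_val
        exact ContinuousAt.comp (f := fun x : Conf I.1.size => I.1.spreadOut x.1)
          (continuousAt_gap (I.1.admissible_spreadOut x) i j) h2.continuousAt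
      -- The gap of an inequivalent pair is continuous and positive on the moduli space, hence
      -- bounded below by some e > 0 on the compact closure; any ε < e/2 works.
      obtain ⟨e, he, hle⟩ := (hU I).exists_forall_le' hG.continuousOn (a := 0) (by
        intro u _
        obtain ⟨x, rfl⟩ : ∃ x, M.mk x = u := Quotient.exists_rep u
        refine gap_pos (I.1.admissible_spreadOut x) hij.1 hij.2.1 fun e => hij.2.2 ?_
        exact I.1.cls_eq_iff.1 (x.2 e))
      filter_upwards [Ioo_mem_nhdsGT (half_pos he)] with ε hε x hx _ _ _
      have := hle _ (subset_closure hx)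
      change e ≤ gap (I.1.spreadOut x.1) i j at this
      linarith [hε.2]
    · exact .of_forall fun ε x _ hi hj hr => absurd ⟨hi, hj, hr⟩ hij
  obtain ⟨ε, hε, hpos⟩ := (key.and self_mem_nhdsWithin).exists
  exact ⟨ε, hpos, fun I x hx i j => hε I i j x hx⟩

/-- Over U the cutoff is 1 by the choice of ε, and outside U both sides vanish with ξ. -/
lemma extMap_of_mem_stratum (hε : 0 < ε) {I : StableDecomp k} {U : Set (M I.size)}
    (h : ∀ x : Conf I.size, M.mk x ∈ U → ∀ i j, i ≠ 0 → j ≠ 0 → ¬ I.rel i j →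
      2 * ε ≤ gap (I.spreadOut x.1) i j) (ξ : CompactlySupported U Z) (x : stratum I) :
    extMap hε I ξ.1 x = ξ.1.fn (proj I x) := by
  rw [extMap_eq_stratumSmooth, stratumSmooth_fn]
  obtain ⟨y, hy⟩ : ∃ y, M.mk y = proj I x := Quotient.exists_rep _
  rw [← hy, stratumMap_mk, extension]
  simp only [StableDecomp.spreadOut_rep]
  rw [evalConf_of_injective _ y.2]
  by_cases hyU : M.mk y ∈ U
  · have hχ : cutoff ε I.rel (I.spreadOut y.1) = 1 :=
      cutoff_eq_one hε (fun i j hij => congrArg y.1 (I.cls_eq_iff.2 hij)) (h y hyU)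
    rw [hχ, one_smul]
  · have h0 : ξ.1.fn (M.mk y) = 0 := by
      by_contra hne
      exact hyU (ξ.2.2 (subset_tsupport _ hne))
    rw [h0]
    exact smul_zero _

end Extension

end

end CoherentMaps

theorem mainTheorem7 {Z : Type*} [NormedAddCommGroup Z] [NormedSpace ℝ Z] [CompleteSpace Z]
    (k : ℕ) (hk : 3 ≤ k)
    (U : ∀ I : LargeDecomp k, Set (M I.1.size))
    (hU_open : ∀ I, IsOpen (U I)) (hU_compact : ∀ I, IsCompact (closure (U I))) :
    ∃ E : ∀ I : LargeDecomp k, CompactlySupported (U I) Z →L[ℝ] Coh k Z,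
      (∀ (I : LargeDecomp k) (ξ : CompactlySupported (U I) Z) (x : stratum I.1),
        (E I ξ).fn x = ξ.1.fn (proj I.1 x)) ∧
      (∀ I J : LargeDecomp k, I ≠ J →
        ∀ (ξ : CompactlySupported (U I) Z) (η : CompactlySupported (U J) Z),
          Disjoint (tsupport (E I ξ).fn) (tsupport (E J η).fn)) ∧
      ∀ Zs : Set Z, IsOpen Zs → (0 : Z) ∈ Zs → StarConvex ℝ 0 Zs →
        ∀ (I : LargeDecomp k) (ξ : CompactlySupported (U I) Z),
          (∀ u ∈ U I, ξ.1.fn u ∈ Zs) → (E I ξ).MapsInto Zs := by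
  obtain ⟨ε, hε, hgap⟩ := exists_gap_lower_bound hU_compact
  refine ⟨fun I => ⟨(extCoh hε I).comp (CompactlySupported (U I) Z).subtype,
    continuous_extCoh hε I (hU_compact I)⟩, fun I ξ x => ?_, fun I J hIJ ξ η => ?_,
    fun Zs _ h0 hs I ξ hξ => ?_⟩
  · exact extMap_of_mem_stratum hε (hgap I) ξ x
  · exact disjoint_tsupport_extMap hε (fun h => hIJ (Subtype.ext h)) ξ.1 η.1
  · refine mapsInto_of_starConvex h0 hs fun x => ?_
    obtain ⟨z, rfl⟩ : ∃ z, MBar.mk z = x := Quotient.exists_rep x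
    refine extension_mem h0 hs (fun u => ?_) z.root
    -- The values off U are 0, which lies in the star-shaped set.
    by_cases hu : u ∈ U I
    · exact hξ u hu
    · have hu0 : ξ.1.fn u = 0 := by
        by_contra hne
        exact hu (ξ.2.2 (subset_tsupport _ hne))
      exact hu0 ▸ h0
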